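/- For a simple graph $G$ and an integer $k\ge 3$, let $D(G,C_k^{\circlearrowright})$ denote the number of orientations of $G$ (each edge receives exactly one of its two directions) that contain no directed cycle of length $k$ as a subgraph. Let $G(n,p)$ be the binomial random graph on $n$ vertices, in which each pair of vertices is an edge independently with probability $p$, and let $\log$ be the natural logarithm. **Theorem.** Let $k\ge 3$. There exist constants $C>0$ and $a\in\mathbb{N}$, depending only on $k$, such that for every sequence $p=p(n)\in[0,1]$ with $p\gg n^{-1+1/(k-1)}$ (that is, $n^{-1+1/(k-1)}=o(p(n))$ as $n\to\infty$), the probability that $$\frac{1}{C(\log n)^a}\cdot\frac{n}{p^{1/(k-2)}}\;\le\;\log D\big(G(n,p),C_k^{\circlearrowright}\big)\;\le\; C(\log n)^a\cdot\frac{n}{p^{1/(k-2)}}$$ tends to $1$ as $n\to\infty$. In other words, with high probability $\log D(G(n,p),C_k^{\circlearrowright})=\widetilde\Theta\big(n/p^{1/(k-2)}\big)$. -/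

import Mathlib

open Filter Topology Asymptotics

/-- `D` is an orientation of the simple graph `G`: each edge of `G` receives exactly one of its two
directions, and `D` has no further arcs (in particular no loops). -/
structure IsOrientation {V : Type*} (D : Digraph V) (G : SimpleGraph V) : Prop where
  adj_iff : ∀ u v, G.Adj u v ↔ D.Adj u v ∨ D.Adj v u
  asymm : ∀ u v, D.Adj u v → ¬ D.Adj v u

/-- `D` contains a copy of `H` as a (not necessarily induced) subdigraph. -/
def ContainsDigraph {V W : Type*} (D : Digraph V) (H : Digraph W) : Prop :=
  ∃ f : W ↪ V, ∀ i j, H.Adj i j → D.Adj (f i) (f j)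

/-- The directed cycle of length `k`: vertices `0, …, k - 1` and arcs `i → i + 1 (mod k)`. -/
def directedCycle (k : ℕ) : Digraph (Fin k) where
  Adj i j := (j : ℕ) = ((i : ℕ) + 1) % k

/-- The number `D(G, H)` of `H`-free orientations of `G`. -/
noncomputable def numFreeOrientations {V W : Type*} (G : SimpleGraph V) (H : Digraph W) : ℕ :=
  {D : Digraph V | IsOrientation D G ∧ ¬ ContainsDigraph D H}.ncard

/-! Write k = q + 3 and s = p^(1/(k-2)), so that p = s^(q+1) and the claim is log D ≈ n/s up to
powers of log n.

Upper bound: a first moment over pairs (graph, orientation), with the vertices exposed one at a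
time. A typical graph satisfies `IsPseudorandom`, and then each of its orientations expands: up to
logarithms, in every set Z of at least m ≈ s^(-(q+2)) vertices some vertex reaches a proportion δ ≈
s of Z by directed paths with q + 1 arcs inside Z (`IsPseudorandom.isPathExpanding`). No such path
may run from an out-neighbour to an in-neighbour of a new vertex, since it would close a k-cycle. So
each well-placed out-neighbour rules out a proportion δ of the remaining candidates as
in-neighbours; after about (log n)/δ of them fewer than m undecided vertices are left, of total
weight at most (1+p)^m (`sum_closedLabels_le`). As pm ≈ 1/s, each vertex contributes a factor
exp(Õ(1/s)). `sum_freeExpandingDigraphs_le` multiplies these factors, and Markov's inequality gives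
`graphProb_upper_bound`.

Lower bound: cut the vertices into consecutive blocks of length about s^(-(q+2))/log n, or 2 if this
is too short. Edges inside a block that lie in no k-cycle of that block are oriented freely, all
others forwards. A directed k-cycle never returns to an earlier block, so it stays in one block,
where it consists of forward edges only, which is absurd (`flipOrientation_free`). For this block
length, k-cycles inside blocks are rarer than edges by a factor log n, so most of the block edges,
at least about n/(s log n) in number, are free (`graphProb_lower_bound`). The density hypothesis
guarantees that a block fits into the n vertices. -/

section RandomGraphSums

/-! ### The binomial random graph as a finite weighted sum. -/

open Finset
open scoped Classical

/-- The pairs `(i, j)` with `i < j`, indexing the potential edges of a graph on `Fin n`. -/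
def ltPairs (n : ℕ) : Finset (Fin n × Fin n) := univ.filter fun e => e.1 < e.2

/-- The number of edges of the relation `A` among the pairs in `T`. -/
noncomputable def edgeCount {n : ℕ} (A : Fin n → Fin n → Prop) (T : Finset (Fin n × Fin n)) : ℕ :=
  #(T.filter fun e => A e.1 e.2)

/-- The probability of a graph with adjacency relation `A` in the binomial model. -/
noncomputable def graphWeight {n : ℕ} (p : ℝ) (A : Fin n → Fin n → Prop) : ℝ :=
  ∏ j, ∏ i, if i < j then (if A i j then p else 1 - p) else 1

theorem graphWeight_eq_prod {n : ℕ} (p : ℝ) (A : Fin n → Fin n → Prop) :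
    graphWeight p A = ∏ e ∈ ltPairs n, if A e.1 e.2 then p else 1 - p := by
  rw [graphWeight, Finset.prod_comm, ltPairs, Finset.prod_filter, ← Finset.univ_product_univ,
    Finset.prod_product]

theorem graphWeight_nonneg {n : ℕ} {p : ℝ} (h0 : 0 ≤ p) (h1 : p ≤ 1) (A : Fin n → Fin n → Prop) :
    0 ≤ graphWeight p A := by
  rw [graphWeight_eq_prod]
  refine Finset.prod_nonneg fun e _ => ?_
  split_ifs <;> linarith

/-- Independence of the edges: graphs correspond to sets of increasing pairs, and the product of
sums expands over such sets. The expectations below are obtained by choosing `h`. -/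
theorem sum_prod_ltPairs {n : ℕ} (h : Fin n × Fin n → Prop → ℝ) :
    ∑ G : SimpleGraph (Fin n), ∏ e ∈ ltPairs n, h e (G.Adj e.1 e.2)
      = ∏ e ∈ ltPairs n, (h e True + h e False) := by
  rw [Finset.prod_add]
  refine Finset.sum_bij' (i := fun G _ => (ltPairs n).filter fun e => G.Adj e.1 e.2)
    (j := fun T _ => SimpleGraph.fromRel fun i j => i < j ∧ (i, j) ∈ T) ?_ ?_ ?_ ?_ ?_
  · intro G _
    simp
  · intro T _
    simp
  · intro G _
    ext i j
    simp only [ltPairs, SimpleGraph.fromRel_adj, mem_filter, mem_univ, true_and]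
    constructor
    · rintro ⟨_, h | h⟩
      · exact h.2.2
      · exact h.2.2.symm
    · intro hij
      refine ⟨hij.ne, ?_⟩
      rcases lt_or_gt_of_ne hij.ne with h | h
      · exact Or.inl ⟨h, h, hij⟩
      · exact Or.inr ⟨h, h, hij.symm⟩
  · intro T hT
    ext ⟨i, j⟩
    have hsub := Finset.mem_powerset.1 hT
    simp only [ltPairs, SimpleGraph.fromRel_adj, mem_filter, mem_univ, true_and]
    constructor
    · rintro ⟨hij, _, h | h⟩
      · exact h.2
      · exact absurd h.1 (not_lt.2 hij.le)
    · intro h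
      have hij : i < j := by simpa [ltPairs] using hsub h
      exact ⟨hij, hij.ne, Or.inl ⟨hij, h⟩⟩
  · intro G _
    rw [← Finset.prod_filter_mul_prod_filter_not (ltPairs n) (fun e => G.Adj e.1 e.2)]
    congr 1
    · refine Finset.prod_congr rfl fun e he => ?_
      rw [eq_true (Finset.mem_filter.1 he).2]
    · rw [← Finset.filter_not]
      refine Finset.prod_congr rfl fun e he => ?_
      rw [eq_false (Finset.mem_filter.1 he).2]

/-- Generating function of the number of edges inside a set of pairs. -/
theorem sum_graphWeight_mul_pow {n : ℕ} (p c : ℝ) {T : Finset (Fin n × Fin n)}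
    (hT : T ⊆ ltPairs n) :
    ∑ G : SimpleGraph (Fin n), graphWeight p G.Adj * c ^ edgeCount G.Adj T
      = (1 - p + p * c) ^ #T := by
  have key := sum_prod_ltPairs (n := n)
    (fun e a => (if a then p else 1 - p) * (if e ∈ T then (if a then c else 1) else 1))
  have h1 : ∀ G : SimpleGraph (Fin n), graphWeight p G.Adj * c ^ edgeCount G.Adj T
      = ∏ e ∈ ltPairs n, (if G.Adj e.1 e.2 then p else 1 - p) *
          (if e ∈ T then (if G.Adj e.1 e.2 then c else 1) else 1) := by
    intro G
    rw [Finset.prod_mul_distrib, ← graphWeight_eq_prod]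
    congr 1
    rw [← Finset.prod_filter, Finset.filter_mem_eq_inter, Finset.inter_eq_right.2 hT,
      ← Finset.prod_filter, Finset.prod_const, edgeCount]
  rw [Finset.sum_congr rfl fun G _ => h1 G, key]
  refine (Finset.prod_congr (g := fun e => if e ∈ T then 1 - p + p * c else 1) rfl ?_).trans ?_
  · intro e _
    by_cases he : e ∈ T
    · simp only [he, if_true, if_false]; ring
    · simp [he]
  · rw [← Finset.prod_filter, Finset.filter_mem_eq_inter, Finset.inter_eq_right.2 hT,
      Finset.prod_const]

theorem sum_graphWeight {n : ℕ} (p : ℝ) :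
    ∑ G : SimpleGraph (Fin n), graphWeight p G.Adj = 1 := by
  simpa using sum_graphWeight_mul_pow (n := n) p 1 (T := ∅) (by simp)

/-- The probability that all pairs of `T` are edges. -/
theorem sum_graphWeight_filter_subset {n : ℕ} (p : ℝ) {T : Finset (Fin n × Fin n)}
    (hT : T ⊆ ltPairs n) :
    ∑ G : SimpleGraph (Fin n) with ∀ e ∈ T, G.Adj e.1 e.2, graphWeight p G.Adj = p ^ #T := by
  have key := sum_prod_ltPairs (n := n)
    (fun e a => (if a then p else 1 - p) * (if e ∈ T then (if a then 1 else 0) else 1))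
  have h1 : ∀ G : SimpleGraph (Fin n),
      (if ∀ e ∈ T, G.Adj e.1 e.2 then graphWeight p G.Adj else 0)
      = ∏ e ∈ ltPairs n, (if G.Adj e.1 e.2 then p else 1 - p) *
          (if e ∈ T then (if G.Adj e.1 e.2 then 1 else 0) else 1) := by
    intro G
    rw [Finset.prod_mul_distrib, ← graphWeight_eq_prod]
    rw [← Finset.prod_filter, Finset.filter_mem_eq_inter, Finset.inter_eq_right.2 hT,
      Finset.prod_ite_zero]
    simp
  rw [Finset.sum_filter, Finset.sum_congr rfl fun G _ => h1 G, key]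
  refine (Finset.prod_congr (g := fun e => if e ∈ T then p else 1) rfl ?_).trans ?_
  · intro e _
    by_cases he : e ∈ T <;> simp [he]
  · rw [← Finset.prod_filter, Finset.filter_mem_eq_inter, Finset.inter_eq_right.2 hT,
      Finset.prod_const]

theorem edgeSet_ncard_eq_edgeCount {n : ℕ} (G : SimpleGraph (Fin n)) :
    G.edgeSet.ncard = edgeCount G.Adj (ltPairs n) := by
  rw [edgeCount, ← Set.ncard_coe_finset]
  symm
  refine Set.ncard_congr (fun e _ => s(e.1, e.2)) ?_ ?_ ?_
  · rintro ⟨i, j⟩ h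
    simpa using (Finset.mem_filter.1 (Finset.mem_coe.1 h)).2
  · rintro ⟨i, j⟩ ⟨i', j'⟩ h h' heq
    simp only [ltPairs, coe_filter, mem_filter, mem_univ, true_and, Set.mem_ofPred_eq] at h h'
    rcases Sym2.eq_iff.1 heq with ⟨h1, h2⟩ | ⟨h1, h2⟩
    · simp_all
    · have e1 : i = j' := h1
      have e2 : j = i' := h2
      subst e1 e2
      exact absurd h.1 (not_lt.2 h'.1.le)
  · intro e
    induction e with
    | _ i j =>
      intro h
      have hij : G.Adj i j := by simpa using h
      rcases lt_or_gt_of_ne hij.ne with h | h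
      · exact ⟨(i, j), by simp [ltPairs, h, hij], rfl⟩
      · exact ⟨(j, i), by simp [ltPairs, h, hij.symm], Sym2.eq_swap⟩

theorem card_ltPairs (n : ℕ) : #(ltPairs n) = n.choose 2 := by
  have h := edgeSet_ncard_eq_edgeCount (⊤ : SimpleGraph (Fin n))
  have h2 : edgeCount (⊤ : SimpleGraph (Fin n)).Adj (ltPairs n) = #(ltPairs n) := by
    rw [edgeCount]
    congr 1
    ext e
    simp only [mem_filter, and_iff_left_iff_imp]
    intro he
    have : e.1 < e.2 := by simpa [ltPairs] using he
    simpa using this.ne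
  rw [← h2, ← h, SimpleGraph.edgeSet_top, ← Nat.card_coe_set_eq,
    Nat.card_eq_fintype_card, Sym2.card_diagSet_compl, Fintype.card_fin]

theorem graphWeight_eq_pow {n : ℕ} (p : ℝ) (A : Fin n → Fin n → Prop) :
    graphWeight p A
      = p ^ edgeCount A (ltPairs n) * (1 - p) ^ (n.choose 2 - edgeCount A (ltPairs n)) := by
  rw [graphWeight_eq_prod, Finset.prod_ite, Finset.prod_const, Finset.prod_const, edgeCount,
    ← card_ltPairs]
  congr 2
  have := Finset.card_filter_add_card_filter_not (s := ltPairs n) (fun e => A e.1 e.2)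
  omega

theorem binomialRandom_real_singleton {n : ℕ} (p : unitInterval) (G : SimpleGraph (Fin n)) :
    (SimpleGraph.binomialRandom (Fin n) p).real {G} = graphWeight (p : ℝ) G.Adj := by
  rw [MeasureTheory.measureReal_def, SimpleGraph.binomialRandom_singleton, graphWeight_eq_pow,
    edgeSet_ncard_eq_edgeCount]
  simp

theorem binomialRandom_real_eq_sum {n : ℕ} (p : unitInterval) (S : Set (SimpleGraph (Fin n))) :
    (SimpleGraph.binomialRandom (Fin n) p).real S
      = ∑ G : SimpleGraph (Fin n) with G ∈ S, graphWeight (p : ℝ) G.Adj := by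
  have hm : ∀ G : SimpleGraph (Fin n), MeasurableSet ({G} : Set (SimpleGraph (Fin n))) := by
    intro G
    have : ({G} : Set (SimpleGraph (Fin n))) = SimpleGraph.edgeSet ⁻¹' {G.edgeSet} := by
      ext H
      simp
    rw [this]
    exact SimpleGraph.measurableEmbedding_edgeSet.measurable (MeasurableSet.singleton _)
  have : MeasurableSingletonClass (SimpleGraph (Fin n)) := ⟨hm⟩
  rw [← Finset.sum_congr rfl fun G _ => binomialRandom_real_singleton p G,
    MeasureTheory.sum_measureReal_singleton]
  congr 1
  ext G
  simp

end RandomGraphSums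

/-! ### Counting the admissible neighbourhoods of a new vertex. -/

section NeighbourhoodLabels

open Finset
open scoped Classical

variable {V : Type*} [Fintype V]

/-- The probability-type weight of a labelling of the vertices by the direction of the arc joining
them to a new vertex (`none`: no arc; `some true`: an arc from the new vertex; `some false`: an arc
to the new vertex). -/
noncomputable def labelWeight (p : ℝ) (c : V → Option Bool) : ℝ :=
  ∏ i, if c i = none then 1 - p else p

theorem labelWeight_nonneg {p : ℝ} (h0 : 0 ≤ p) (h1 : p ≤ 1) (c : V → Option Bool) :
    0 ≤ labelWeight p c := by
  refine Finset.prod_nonneg fun i _ => ?_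
  split_ifs <;> linarith

variable [DecidableEq V]

/-- The labellings whose out-part lies in `C`, whose in-part avoids `S`, and in which no vertex of
the in-part is in `R a` for some `a` in the out-part. -/
noncomputable def closedLabels (R : V → Finset V) (C S : Finset V) : Finset (V → Option Bool) :=
  univ.filter fun c => (∀ i, c i = some true → i ∈ C) ∧ (∀ i, c i = some false → i ∉ S) ∧
    ∀ a b, c a = some true → b ∈ R a → c b ≠ some false

/-- Once the condition on `R` is dropped, the weight factorises over vertices. All three labels, of
weight 1 - p + 2p, are available only on `C \ S`; elsewhere the factor is at most 1. -/
theorem sum_closedLabels_le_pow {p : ℝ} (h0 : 0 ≤ p) (h1 : p ≤ 1) (R : V → Finset V)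
    (C S : Finset V) :
    ∑ c ∈ closedLabels R C S, labelWeight p c ≤ (1 + p) ^ #(C \ S) := by
  let t : V → Finset (Option Bool) := fun i =>
    univ.filter fun o => (o = some true → i ∈ C) ∧ (o = some false → i ∉ S)
  have hsub : closedLabels R C S ⊆ Fintype.piFinset t := by
    intro c hc
    simp only [closedLabels, mem_filter, mem_univ, true_and] at hc
    simp only [t, Fintype.mem_piFinset, mem_filter, mem_univ, true_and]
    exact fun i => ⟨hc.1 i, hc.2.1 i⟩
  calc ∑ c ∈ closedLabels R C S, labelWeight p c
      ≤ ∑ c ∈ Fintype.piFinset t, labelWeight p c :=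
        Finset.sum_le_sum_of_subset_of_nonneg hsub fun c _ _ => labelWeight_nonneg h0 h1 c
    _ = ∏ i, ∑ o ∈ t i, (if o = none then 1 - p else p) := by
        rw [Finset.prod_univ_sum]; rfl
    _ ≤ ∏ i, (if i ∈ C \ S then 1 + p else 1) := by
        refine Finset.prod_le_prod (fun i _ => Finset.sum_nonneg fun o _ => ?_) fun i _ => ?_
        · split_ifs <;> linarith
        · rw [Finset.sum_filter, Fintype.sum_option, Fintype.sum_bool]
          by_cases hC : i ∈ C <;> by_cases hS : i ∈ S <;> (simp [hC, hS]; try linarith)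
    _ = (1 + p) ^ #(C \ S) := by
        rw [← Finset.prod_filter, Finset.prod_const]
        congr 2
        ext
        simp

/-- If every large set `Z` has a vertex `x` for which `R x` covers a proportion `δ` of `Z`, then the
labellings closed under `R` have small total weight. -/
theorem sum_closedLabels_le {p δ : ℝ} (h0 : 0 ≤ p) (h1 : p ≤ 1) (hδ : δ ≤ 1)
    (R : V → Finset V) {m : ℕ} (hm : 0 < m)
    (hR : ∀ Z : Finset V, m ≤ #Z → ∃ x ∈ Z, δ * #Z ≤ #(Z ∩ R x)) (y : ℕ) :
    ∀ (z : ℕ) (C S : Finset V), #(C \ S) ≤ z → (#(C \ S) : ℝ) * (1 - δ) ^ y < m →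
      ∑ c ∈ closedLabels R C S, labelWeight p c ≤ (1 + p) ^ m * (#(C \ S) + 1 : ℝ) ^ y := by
  have hsmall : ∀ (y : ℕ) (C S : Finset V), #(C \ S) < m →
      ∑ c ∈ closedLabels R C S, labelWeight p c ≤ (1 + p) ^ m * (#(C \ S) + 1 : ℝ) ^ y := by
    intro y C S h
    refine (sum_closedLabels_le_pow h0 h1 R C S).trans ?_
    have e1 : (1 + p) ^ #(C \ S) ≤ (1 + p) ^ m := pow_le_pow_right₀ (by linarith) h.le
    have e2 : (1 : ℝ) ≤ (#(C \ S) + 1 : ℝ) ^ y := one_le_pow₀ (by simp)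
    have e3 : 0 ≤ (1 + p) ^ m := by positivity
    nlinarith
  -- `y` bounds how many more branching vertices may become out-neighbours; the inner induction on
  -- `z` lets candidates be erased without spending `y`.
  induction y with
  | zero =>
    intro z C S _ h
    refine hsmall 0 C S ?_
    simpa using h
  | succ y ihy =>
    intro z
    induction z with
    | zero =>
      intro C S hz _
      exact hsmall _ C S (by omega)
    | succ z ihz =>
      intro C S hz hlt
      rcases lt_or_ge #(C \ S) m with hs | hs
      · exact hsmall _ C S hs
      obtain ⟨x, hxZ, hx⟩ := hR _ hs
      have hxC : x ∈ C := (Finset.mem_sdiff.1 hxZ).1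
      have hxS : x ∉ S := (Finset.mem_sdiff.1 hxZ).2
      -- Branch on the vertex `x`: if it is not an out-neighbour it leaves `C`; if it is, all of `R
      -- x` is barred from the in-part and `C \ S` shrinks by the factor 1 - δ.
      have hsub : closedLabels R C S ⊆
          closedLabels R (C.erase x) S ∪ closedLabels R C (S ∪ R x) := by
        intro c hc
        simp only [closedLabels, mem_filter, mem_univ, true_and, mem_union] at hc ⊢
        by_cases hcx : c x = some true
        · right
          refine ⟨hc.1, fun i hi => ?_, hc.2.2⟩
          rintro (h | h)
          · exact hc.2.1 i hi h
          · exact hc.2.2 x i hcx h hi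
        · left
          refine ⟨fun i hi => ?_, hc.2⟩
          refine Finset.mem_erase.2 ⟨?_, hc.1 i hi⟩
          rintro rfl
          exact hcx hi
      have hδ' : 0 ≤ 1 - δ := by linarith
      have ecard1 : #(C.erase x \ S) + 1 = #(C \ S) := by
        rw [Finset.erase_sdiff_comm, Finset.card_erase_add_one hxZ]
      have ecard1' : (#(C.erase x \ S) : ℝ) + 1 = #(C \ S) := by exact_mod_cast ecard1
      have ecard2 : #(C \ (S ∪ R x)) + #((C \ S) ∩ R x) = #(C \ S) := by
        rw [← Finset.card_sdiff_add_card_inter (C \ S) (R x), sdiff_sdiff, Finset.sup_eq_union]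
      have ecard2' : (#(C \ (S ∪ R x)) : ℝ) + #((C \ S) ∩ R x) = #(C \ S) := by
        exact_mod_cast ecard2
      have b1 := ihz (C.erase x) S (by omega)
        (lt_of_le_of_lt (mul_le_mul_of_nonneg_right (by linarith) (by positivity)) hlt)
      have b2 := ihy #(C \ (S ∪ R x)) C (S ∪ R x) le_rfl (by
        refine lt_of_le_of_lt ?_ hlt
        rw [pow_succ, mul_comm ((1 - δ) ^ y), ← mul_assoc]
        refine mul_le_mul_of_nonneg_right ?_ (by positivity)
        linarith)
      have e0 : (0 : ℝ) ≤ (1 + p) ^ m := by positivity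
      have b2' : (1 + p) ^ m * (#(C \ (S ∪ R x)) + 1 : ℝ) ^ y
          ≤ (1 + p) ^ m * (#(C \ S) + 1 : ℝ) ^ y := by
        refine mul_le_mul_of_nonneg_left (pow_le_pow_left₀ (by positivity) ?_ _) e0
        have : (0 : ℝ) ≤ #((C \ S) ∩ R x) := by positivity
        linarith
      -- With Z = #(C \ S), the branches are bounded by Z(Z+1)^y and (Z+1)^y, which add up to
      -- (Z+1)^(y+1).
      have b1' : (1 + p) ^ m * (#(C.erase x \ S) + 1 : ℝ) ^ (y + 1)
          ≤ (1 + p) ^ m * (#(C \ S) * (#(C \ S) + 1 : ℝ) ^ y) := by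
        refine mul_le_mul_of_nonneg_left ?_ e0
        rw [ecard1', pow_succ, mul_comm]
        refine mul_le_mul_of_nonneg_left (pow_le_pow_left₀ (by positivity) (by linarith) _)
          (by positivity)
      calc ∑ c ∈ closedLabels R C S, labelWeight p c
          ≤ ∑ c ∈ closedLabels R (C.erase x) S ∪ closedLabels R C (S ∪ R x), labelWeight p c :=
            Finset.sum_le_sum_of_subset_of_nonneg hsub fun c _ _ => labelWeight_nonneg h0 h1 c
        _ ≤ ∑ c ∈ closedLabels R (C.erase x) S, labelWeight p c
            + ∑ c ∈ closedLabels R C (S ∪ R x), labelWeight p c := by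
            rw [← Finset.sum_union_inter]
            exact le_add_of_nonneg_right
              (Finset.sum_nonneg fun c _ => labelWeight_nonneg h0 h1 c)
        _ ≤ (1 + p) ^ m * (#(C \ S) * (#(C \ S) + 1 : ℝ) ^ y)
            + (1 + p) ^ m * (#(C \ S) + 1 : ℝ) ^ y :=
            add_le_add (b1.trans b1') (b2.trans b2')
        _ = (1 + p) ^ m * (#(C \ S) + 1 : ℝ) ^ (y + 1) := by ring

end NeighbourhoodLabels

/-! ### Exposing the vertices of an oriented graph one at a time. -/

section VertexExposure

open Finset
open scoped Classical

/-- There is a directed path with `r` arcs from `x` to `y` in `D`, all of whose vertices are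
in `Z`. -/
def HasDipathIn {V : Type*} (D : Digraph V) (Z : Finset V) (r : ℕ) (x y : V) : Prop :=
  ∃ f : Fin (r + 1) → V, Function.Injective f ∧ f 0 = x ∧ f (Fin.last r) = y ∧ (∀ i, f i ∈ Z) ∧
    ∀ i : Fin r, D.Adj (f i.castSucc) (f i.succ)

/-- In every set `Z` of at least `m` vertices, some vertex reaches a proportion `δ` of `Z` by
directed paths with `r` arcs inside `Z`. -/
def IsPathExpanding {V : Type*} (D : Digraph V) (r m : ℕ) (δ : ℝ) : Prop :=
  ∀ Z : Finset V, m ≤ #Z → ∃ x ∈ Z, δ * #Z ≤ #(Z.filter fun y => HasDipathIn D Z r x y)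

/-- The digraph induced on the vertices other than the last one. -/
def Digraph.dropLast {n : ℕ} (D : Digraph (Fin (n + 1))) : Digraph (Fin n) where
  Adj i j := D.Adj i.castSucc j.castSucc

/-- The labelling that records how the last vertex is joined to the others. -/
noncomputable def Digraph.lastLabel {n : ℕ} (D : Digraph (Fin (n + 1))) (i : Fin n) : Option Bool :=
  if D.Adj (Fin.last n) i.castSucc then some true
  else if D.Adj i.castSucc (Fin.last n) then some false else none

/-- The oriented graphs on `Fin n` without directed cycle of length `r + 2` that expand. -/
noncomputable def freeExpandingDigraphs (r m : ℕ) (δ : ℝ) (n : ℕ) : Finset (Digraph (Fin n)) :=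
  univ.filter fun D => (∀ u v, D.Adj u v → ¬ D.Adj v u) ∧
    ¬ ContainsDigraph D (directedCycle (r + 2)) ∧ IsPathExpanding D r m δ

theorem Digraph.ext_dropLast_lastLabel {n : ℕ} {D E : Digraph (Fin (n + 1))}
    (hD : ∀ u v, D.Adj u v → ¬ D.Adj v u) (hE : ∀ u v, E.Adj u v → ¬ E.Adj v u)
    (h : D.dropLast = E.dropLast) (hl : D.lastLabel = E.lastLabel) : D = E := by
  have hl' : ∀ i, D.lastLabel i = E.lastLabel i := fun i => congrFun hl i
  ext u v
  induction u using Fin.lastCases with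
  | last =>
    induction v using Fin.lastCases with
    | last =>
      exact ⟨fun h => absurd h (hD _ _ h), fun h => absurd h (hE _ _ h)⟩
    | cast v =>
      have := hl' v
      simp only [Digraph.lastLabel] at this
      split_ifs at this <;> simp_all
  | cast u =>
    induction v using Fin.lastCases with
    | last =>
      have := hl' u
      have h1 := hD u.castSucc (Fin.last n)
      have h2 := hE u.castSucc (Fin.last n)
      simp only [Digraph.lastLabel] at this
      split_ifs at this <;> simp_all
    | cast v =>
      have := congrArg (fun F : Digraph (Fin n) => F.Adj u v) h
      simpa [Digraph.dropLast] using this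

/-- The pairs whose larger element is the last vertex form the factor of the outer product that
splits off. -/
theorem graphWeight_succ {n : ℕ} (p : ℝ) (D : Digraph (Fin (n + 1))) :
    graphWeight p (fun i j => D.Adj i j ∨ D.Adj j i)
      = graphWeight p (fun i j => D.dropLast.Adj i j ∨ D.dropLast.Adj j i)
        * labelWeight p D.lastLabel := by
  rw [graphWeight, Fin.prod_univ_castSucc]
  congr 1
  · rw [graphWeight]
    refine Finset.prod_congr rfl fun j _ => ?_
    rw [Fin.prod_univ_castSucc, if_neg (not_lt.2 (Fin.le_last _)), mul_one]
    rfl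
  · rw [Fin.prod_univ_castSucc, if_neg (lt_irrefl _), mul_one, labelWeight]
    refine Finset.prod_congr rfl fun i _ => ?_
    rw [if_pos (Fin.castSucc_lt_last i), Digraph.lastLabel]
    split_ifs <;> simp_all

theorem ContainsDigraph.of_dropLast {n k : ℕ} {D : Digraph (Fin (n + 1))}
    (h : ContainsDigraph D.dropLast (directedCycle k)) : ContainsDigraph D (directedCycle k) := by
  obtain ⟨f, hf⟩ := h
  exact ⟨f.trans Fin.castSuccEmb, fun i j hij => hf i j hij⟩

/-- Expansion is hereditary because the paths are required to stay inside `Z`, so they avoid the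
deleted vertex. -/
theorem IsPathExpanding.dropLast {n r m : ℕ} {δ : ℝ} {D : Digraph (Fin (n + 1))}
    (h : IsPathExpanding D r m δ) : IsPathExpanding D.dropLast r m δ := by
  intro Z hZ
  obtain ⟨x, hx, hδ⟩ := h (Z.map Fin.castSuccEmb) (by simpa using hZ)
  obtain ⟨x, hxZ, rfl⟩ := Finset.mem_map.1 hx
  refine ⟨x, hxZ, ?_⟩
  rw [Finset.card_map] at hδ
  refine hδ.trans ?_
  rw [Finset.filter_map, Finset.card_map]
  refine Nat.cast_le.2 (Finset.card_le_card ?_)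
  intro y hy
  simp only [mem_filter, Function.comp] at hy ⊢
  refine ⟨hy.1, ?_⟩
  obtain ⟨f, hinj, h0, hl, hfZ, hadj⟩ := hy.2
  have : ∀ i, ∃ z ∈ Z, Fin.castSucc z = f i := fun i => by
    simpa using Finset.mem_map.1 (hfZ i)
  choose g hgZ hg using this
  refine ⟨g, ?_, ?_, ?_, hgZ, ?_⟩
  · intro i j hij
    exact hinj (by rw [← hg i, ← hg j, hij])
  · exact Fin.castSucc_injective _ ((hg _).trans h0)
  · exact Fin.castSucc_injective _ ((hg _).trans hl)
  · intro i
    have := hadj i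
    rw [← hg, ← hg] at this
    exact this

/-- A directed path between an out-neighbour and an in-neighbour of the last vertex closes a
directed cycle. -/
theorem containsDigraph_of_dipath {n r : ℕ} {D : Digraph (Fin (n + 1))} {Z : Finset (Fin n)}
    {a b : Fin n} (ha : D.Adj (Fin.last n) a.castSucc) (hb : D.Adj b.castSucc (Fin.last n))
    (h : HasDipathIn D.dropLast Z r a b) : ContainsDigraph D (directedCycle (r + 2)) := by
  obtain ⟨f, hinj, h0, hl, -, hadj⟩ := h
  refine ⟨⟨Fin.cons (Fin.last n) fun i => (f i).castSucc, ?_⟩, ?_⟩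
  · rw [Fin.cons_injective_iff]
    refine ⟨?_, (Fin.castSucc_injective _).comp hinj⟩
    rintro ⟨i, hi⟩
    exact (Fin.castSucc_lt_last (f i)).ne hi
  · intro i j hij
    simp only [directedCycle] at hij
    simp only [Function.Embedding.coeFn_mk]
    induction i using Fin.cases with
    | zero =>
      have : j = Fin.succ 0 := by
        ext
        rw [hij]
        simp
      rw [this, Fin.cons_zero, Fin.cons_succ, h0]
      exact ha
    | succ i =>
      rw [Fin.cons_succ]
      induction i using Fin.lastCases with
      | last =>
        have : j = 0 := by
          ext
          rw [hij]
          simp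
        rw [this, Fin.cons_zero, hl]
        exact hb
      | cast i =>
        have : j = i.succ.succ := by
          ext
          rw [hij]
          have := i.2
          simp only [Fin.val_succ, Fin.val_castSucc]
          rw [Nat.mod_eq_of_lt (by omega)]
        rw [this, Fin.cons_succ]
        exact hadj i

/-- Each exposed vertex costs one factor from `sum_closedLabels_le`. The bound `N` is fixed while
`n` grows, so that the same `y` and the same factor serve at every step. -/
theorem sum_freeExpandingDigraphs_le {p δ : ℝ} (h0 : 0 ≤ p) (h1 : p ≤ 1) (hδ : δ ≤ 1)
    {r m : ℕ} (hm : 0 < m) (N y : ℕ) (hy : (N : ℝ) * (1 - δ) ^ y < m) (n : ℕ) (hn : n ≤ N) :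
    ∑ D ∈ freeExpandingDigraphs r m δ n, graphWeight p (fun i j => D.Adj i j ∨ D.Adj j i)
      ≤ ((1 + p) ^ m * (N + 1 : ℝ) ^ y) ^ n := by
  induction n with
  | zero =>
    have : ∀ D ∈ freeExpandingDigraphs r m δ 0,
        graphWeight p (fun i j => D.Adj i j ∨ D.Adj j i) = 1 := fun D _ => by simp [graphWeight]
    rw [Finset.sum_congr rfl this, Finset.sum_const, pow_zero, nsmul_eq_mul, mul_one]
    have hle : #(freeExpandingDigraphs r m δ 0) ≤ 1 := by
      refine Finset.card_le_one.2 fun D _ E _ => ?_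
      ext u
      exact u.elim0
    exact_mod_cast hle
  | succ n ih =>
    have ih := ih (by omega)
    let R : Digraph (Fin n) → Fin n → Finset (Fin n) :=
      fun D x => univ.filter fun y => HasDipathIn D univ r x y
    let φ : Digraph (Fin (n + 1)) → (_ : Digraph (Fin n)) × (Fin n → Option Bool) :=
      fun D => ⟨D.dropLast, D.lastLabel⟩
    let F : (_ : Digraph (Fin n)) × (Fin n → Option Bool) → ℝ :=
      fun x => graphWeight p (fun i j => x.1.Adj i j ∨ x.1.Adj j i) * labelWeight p x.2
    have hinj : Set.InjOn φ (freeExpandingDigraphs r m δ (n + 1)) := by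
      intro D hD E hE hDE
      simp only [freeExpandingDigraphs, coe_filter, mem_univ, true_and, Set.mem_ofPred_eq] at hD hE
      simp only [φ, Sigma.mk.injEq, heq_eq_eq] at hDE
      exact Digraph.ext_dropLast_lastLabel hD.1 hE.1 hDE.1 hDE.2
    have hsub : (freeExpandingDigraphs r m δ (n + 1)).image φ ⊆
        (freeExpandingDigraphs r m δ n).sigma fun D => closedLabels (R D) univ ∅ := by
      intro x hx
      obtain ⟨D, hD, rfl⟩ := Finset.mem_image.1 hx
      simp only [freeExpandingDigraphs, mem_filter, mem_univ, true_and] at hD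
      simp only [φ, mem_sigma, freeExpandingDigraphs, closedLabels, mem_filter, mem_univ, true_and]
      refine ⟨⟨fun u v h => hD.1 _ _ h, fun h => hD.2.1 (ContainsDigraph.of_dropLast h),
        hD.2.2.dropLast⟩, fun _ _ => trivial, fun _ _ => Finset.notMem_empty _, ?_⟩
      intro a b ha hb hb'
      simp only [R, mem_filter, mem_univ, true_and] at hb
      refine hD.2.1 (containsDigraph_of_dipath ?_ ?_ hb)
      · simp only [Digraph.lastLabel] at ha
        split_ifs at ha
        · assumption
        · simp at ha
      · simp only [Digraph.lastLabel] at hb'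
        split_ifs at hb'
        · simp at hb'
        · assumption
    have hW : ∀ D ∈ freeExpandingDigraphs r m δ n,
        ∑ c ∈ closedLabels (R D) univ ∅, labelWeight p c ≤ (1 + p) ^ m * (N + 1 : ℝ) ^ y := by
      intro D hD
      simp only [freeExpandingDigraphs, mem_filter, mem_univ, true_and] at hD
      have hnN : (n : ℝ) ≤ N := by exact_mod_cast (by omega : n ≤ N)
      have hcard : #((univ : Finset (Fin n)) \ ∅) = n := by simp
      have := sum_closedLabels_le h0 h1 hδ (R D) hm (fun Z hZ => by
        obtain ⟨x, hx, hxδ⟩ := hD.2.2 Z hZ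
        refine ⟨x, hx, hxδ.trans (Nat.cast_le.2 (Finset.card_le_card ?_))⟩
        intro z hz
        simp only [R, mem_filter, mem_inter, mem_univ, true_and] at hz ⊢
        obtain ⟨hzZ, f, hf⟩ := hz
        exact ⟨hzZ, f, hf.1, hf.2.1, hf.2.2.1, fun _ => Finset.mem_univ _, hf.2.2.2.2⟩)
        y n univ ∅ hcard.le (by
          rw [hcard]
          exact lt_of_le_of_lt
            (mul_le_mul_of_nonneg_right hnN (pow_nonneg (by linarith) _)) hy)
      rw [hcard] at this
      refine this.trans (mul_le_mul_of_nonneg_left ?_ (by positivity))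
      exact pow_le_pow_left₀ (by positivity) (by linarith) _
    calc ∑ D ∈ freeExpandingDigraphs r m δ (n + 1),
          graphWeight p (fun i j => D.Adj i j ∨ D.Adj j i)
        = ∑ D ∈ freeExpandingDigraphs r m δ (n + 1), F (φ D) :=
          Finset.sum_congr rfl fun D _ => graphWeight_succ p D
      _ = ∑ x ∈ (freeExpandingDigraphs r m δ (n + 1)).image φ, F x :=
          (Finset.sum_image hinj).symm
      _ ≤ ∑ x ∈ (freeExpandingDigraphs r m δ n).sigma fun D => closedLabels (R D) univ ∅, F x :=
          Finset.sum_le_sum_of_subset_of_nonneg hsub fun x _ _ =>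
            mul_nonneg (graphWeight_nonneg h0 h1 _) (labelWeight_nonneg h0 h1 _)
      _ = ∑ D ∈ freeExpandingDigraphs r m δ n, graphWeight p (fun i j => D.Adj i j ∨ D.Adj j i)
            * ∑ c ∈ closedLabels (R D) univ ∅, labelWeight p c := by
          rw [Finset.sum_sigma]
          refine Finset.sum_congr rfl fun D _ => ?_
          rw [Finset.mul_sum]
      _ ≤ ∑ D ∈ freeExpandingDigraphs r m δ n, graphWeight p (fun i j => D.Adj i j ∨ D.Adj j i)
            * ((1 + p) ^ m * (N + 1 : ℝ) ^ y) :=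
          Finset.sum_le_sum fun D hD =>
            mul_le_mul_of_nonneg_left (hW D hD) (graphWeight_nonneg h0 h1 _)
      _ ≤ ((1 + p) ^ m * (N + 1 : ℝ) ^ y) ^ (n + 1) := by
          rw [← Finset.sum_mul, pow_succ]
          exact mul_le_mul_of_nonneg_right ih (by positivity)

end VertexExposure

/-! ### Edge distribution, and growing directed paths layer by layer. -/

section Pseudorandom

open Finset
open scoped Classical

/-- The pairs `i < j` inside `B`. -/
noncomputable def insidePairs {n : ℕ} (B : Finset (Fin n)) : Finset (Fin n × Fin n) :=
  (ltPairs n).filter fun e => e.1 ∈ B ∧ e.2 ∈ B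

/-- The pairs `i < j` between `X` and `Y`. -/
noncomputable def crossPairs {n : ℕ} (X Y : Finset (Fin n)) : Finset (Fin n × Fin n) :=
  (ltPairs n).filter fun e => e.1 ∈ X ∧ e.2 ∈ Y ∨ e.1 ∈ Y ∧ e.2 ∈ X

/-- Edge distribution of a typical binomial random graph. -/
structure IsPseudorandom {n : ℕ} (p : ℝ) (G : SimpleGraph (Fin n)) : Prop where
  lower : ∀ B : Finset (Fin n), B.Nonempty →
    p * #(insidePairs B) / 2 - 3 * #B * Real.log n ≤ edgeCount G.Adj (insidePairs B)
  upper : ∀ X Y : Finset (Fin n), X.Nonempty → Y.Nonempty →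
    edgeCount G.Adj (crossPairs X Y) ≤ 2 * p * (#X * #Y) + 3 * (#X + #Y) * Real.log n

theorem card_mul_pred_le_insidePairs {n : ℕ} (B : Finset (Fin n)) :
    (#B : ℝ) * (#B - 1) ≤ 2 * #(insidePairs B) := by
  have hsub : B.offDiag ⊆ insidePairs B ∪ (insidePairs B).image Prod.swap := by
    rintro ⟨i, j⟩ h
    obtain ⟨hi, hj, hij⟩ := Finset.mem_offDiag.1 h
    simp only [insidePairs, ltPairs, mem_union, mem_filter, mem_univ, true_and, mem_image]
    rcases lt_or_gt_of_ne hij with h | h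
    · exact Or.inl ⟨h, hi, hj⟩
    · exact Or.inr ⟨(j, i), ⟨h, hj, hi⟩, rfl⟩
  have h1 : #B * #B - #B ≤ #(insidePairs B) + #(insidePairs B) := by
    rw [← Finset.offDiag_card]
    exact (Finset.card_le_card hsub).trans ((Finset.card_union_le _ _).trans
      (Nat.add_le_add_left Finset.card_image_le _))
  have h2 : #B * #B ≤ 2 * #(insidePairs B) + #B := by omega
  have h3 : (#B : ℝ) * #B ≤ 2 * #(insidePairs B) + #B := by exact_mod_cast h2
  linarith

theorem card_crossPairs_le {n : ℕ} (X Y : Finset (Fin n)) : #(crossPairs X Y) ≤ #X * #Y := by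
  have hsub : crossPairs X Y ⊆ (X ×ˢ Y).image fun e => (min e.1 e.2, max e.1 e.2) := by
    rintro ⟨i, j⟩ h
    simp only [crossPairs, ltPairs, mem_filter, mem_univ, true_and] at h
    simp only [mem_image, mem_product, Prod.mk.injEq, Prod.exists]
    obtain ⟨hij, ⟨hi, hj⟩ | ⟨hi, hj⟩⟩ := h
    · exact ⟨i, j, ⟨hi, hj⟩, min_eq_left hij.le, max_eq_right hij.le⟩
    · exact ⟨j, i, ⟨hj, hi⟩, min_eq_right hij.le, max_eq_left hij.le⟩
  exact (Finset.card_le_card hsub).trans (Finset.card_image_le.trans (Finset.card_product _ _).le)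

theorem sum_outDegree_eq_card {V : Type*} (D : Digraph V) (X Y : Finset V) :
    ∑ x ∈ X, #(Y.filter fun y => D.Adj x y) = #((X ×ˢ Y).filter fun e => D.Adj e.1 e.2) := by
  simp only [Finset.card_filter, Finset.sum_product]

theorem IsOrientation.edgeCount_insidePairs_le {n : ℕ} {D : Digraph (Fin n)}
    {G : SimpleGraph (Fin n)} (h : IsOrientation D G) (B : Finset (Fin n)) :
    edgeCount G.Adj (insidePairs B) ≤ ∑ x ∈ B, #(B.filter fun y => D.Adj x y) := by
  rw [sum_outDegree_eq_card, edgeCount]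
  refine Finset.card_le_card_of_injOn (fun e => if D.Adj e.1 e.2 then e else e.swap) ?_ ?_
  · rintro ⟨i, j⟩ he
    simp only [insidePairs, ltPairs, coe_filter, mem_filter, mem_univ, true_and,
      Set.mem_ofPred_eq] at he
    have := (h.adj_iff i j).1 he.2
    by_cases hij : D.Adj i j
    · simp [hij, he]
    · simp [hij, he] at this ⊢
      exact this
  · rintro ⟨i, j⟩ he ⟨i', j'⟩ he' heq
    simp only [insidePairs, ltPairs, coe_filter, mem_filter, mem_univ, true_and,
      Set.mem_ofPred_eq] at he he'
    have h1 := he.1.1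
    have h2 := he'.1.1
    simp only at heq
    split_ifs at heq <;> simp only [Prod.swap, Prod.mk.injEq] at heq ⊢
    · exact heq
    · rw [heq.1, heq.2] at h1
      exact absurd h1 (not_lt.2 h2.le)
    · rw [← heq.1, ← heq.2] at h2
      exact absurd h1 (not_lt.2 h2.le)
    · exact heq.symm

/-- Even if `X` and `Y` overlap, no edge is counted twice, since it carries only one arc. -/
theorem IsOrientation.sum_outDegree_le {n : ℕ} {D : Digraph (Fin n)}
    {G : SimpleGraph (Fin n)} (h : IsOrientation D G) (X Y : Finset (Fin n)) :
    ∑ x ∈ X, #(Y.filter fun y => D.Adj x y) ≤ edgeCount G.Adj (crossPairs X Y) := by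
  rw [sum_outDegree_eq_card, edgeCount]
  have hG : ∀ i j, D.Adj i j → G.Adj i j := fun i j hij => (h.adj_iff i j).2 (Or.inl hij)
  refine Finset.card_le_card_of_injOn (fun e => if e.1 < e.2 then e else e.swap) ?_ ?_
  · rintro ⟨i, j⟩ he
    simp only [coe_filter, mem_product, Set.mem_ofPred_eq] at he
    have hne := (hG _ _ he.2).ne
    have hadj := hG _ _ he.2
    by_cases hij : i < j
    · simp [hij, he, crossPairs, ltPairs, hadj]
    · have : j < i := lt_of_le_of_ne (not_lt.1 hij) hne.symm
      simp [hij, this, he, crossPairs, ltPairs, hadj.symm]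
  · rintro ⟨i, j⟩ he ⟨i', j'⟩ he' heq
    simp only [coe_filter, mem_product, Set.mem_ofPred_eq] at he he'
    simp only at heq
    split_ifs at heq <;> simp only [Prod.swap, Prod.mk.injEq] at heq ⊢
    · exact heq
    · exact absurd he'.2 (h.asymm _ _ (heq.1 ▸ heq.2 ▸ he.2))
    · exact absurd he'.2 (h.asymm _ _ (heq.1 ▸ heq.2 ▸ he.2))
    · exact ⟨heq.2, heq.1⟩

theorem HasDipathIn.mono {V : Type*} {D : Digraph V} {U Z : Finset V} {r : ℕ} {x y : V}
    (h : HasDipathIn D U r x y) (hU : U ⊆ Z) : HasDipathIn D Z r x y := by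
  obtain ⟨f, hf⟩ := h
  exact ⟨f, hf.1, hf.2.1, hf.2.2.1, fun i => hU (hf.2.2.2.1 i), hf.2.2.2.2⟩

theorem HasDipathIn.extend {V : Type*} {D : Digraph V} {U W : Finset V} {r : ℕ} {x y z : V}
    (h : HasDipathIn D U r x y) (hUW : U ⊆ W) (hzU : z ∉ U) (hzW : z ∈ W) (hyz : D.Adj y z) :
    HasDipathIn D W (r + 1) x z := by
  obtain ⟨f, hinj, h0, hl, hU, hadj⟩ := h
  refine ⟨Fin.snoc f z, ?_, ?_, ?_, ?_, ?_⟩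
  · rw [Fin.snoc_injective_iff]
    refine ⟨hinj, ?_⟩
    rintro ⟨i, rfl⟩
    exact hzU (hU i)
  · rw [← Fin.castSucc_zero, Fin.snoc_castSucc, h0]
  · rw [Fin.snoc_last]
  · intro i
    induction i using Fin.lastCases with
    | last => rwa [Fin.snoc_last]
    | cast i => rw [Fin.snoc_castSucc]; exact hUW (hU i)
  · intro i
    induction i using Fin.lastCases with
    | last =>
      rw [Fin.succ_last, Fin.snoc_last, Fin.snoc_castSucc, hl]
      exact hyz
    | cast i =>
      rw [Fin.succ_castSucc, Fin.snoc_castSucc, Fin.snoc_castSucc]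
      exact hadj i

/-- Iteratively delete from `Z` the vertices with fewer than `d` remaining out-neighbours. -/
noncomputable def outCore {V : Type*} (D : Digraph V) (d : ℝ) (Z : Finset V) : ℕ → Finset V
  | 0 => Z
  | j + 1 => (outCore D d Z j).filter fun x =>
      d ≤ #((outCore D d Z j).filter fun y => D.Adj x y)

theorem outCore_subset {V : Type*} (D : Digraph V) (d : ℝ) (Z : Finset V) (j : ℕ) :
    outCore D d Z j ⊆ Z := by
  induction j with
  | zero => exact Finset.Subset.refl _
  | succ j ih => exact (Finset.filter_subset _ _).trans ih

/-- The vertices deleted in one round have fewer than `d` out-neighbours among themselves, so each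
round loses at most a proportion 1/r of `Z`. -/
theorem card_outCore {V : Type*} {D : Digraph V} {d : ℝ} {Z : Finset V} {r : ℕ}
    (hB : ∀ B ⊆ Z, (∀ x ∈ B, (#(B.filter fun y => D.Adj x y) : ℝ) < d) → r * #B ≤ #Z) (j : ℕ) :
    r * #Z ≤ r * #(outCore D d Z j) + j * #Z := by
  induction j with
  | zero => simp [outCore]
  | succ j ih =>
    have hb := hB (outCore D d Z j \ outCore D d Z (j + 1))
      (Finset.sdiff_subset.trans (outCore_subset D d Z j)) (by
        intro x hx
        have hx1 := (Finset.mem_sdiff.1 hx).1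
        have hx2 : ¬ d ≤ #((outCore D d Z j).filter fun y => D.Adj x y) := fun h =>
          (Finset.mem_sdiff.1 hx).2 (Finset.mem_filter.2 ⟨hx1, h⟩)
        refine lt_of_le_of_lt ?_ (not_le.1 hx2)
        exact Nat.cast_le.2 (Finset.card_le_card
          (Finset.filter_subset_filter _ Finset.sdiff_subset)))
    have hsub : outCore D d Z (j + 1) ⊆ outCore D d Z j := Finset.filter_subset _ _
    have hc := Finset.card_sdiff_add_card_eq_card hsub
    have hc' : r * #(outCore D d Z j) = r * #(outCore D d Z j \ outCore D d Z (j + 1))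
        + r * #(outCore D d Z (j + 1)) := by rw [← hc, mul_add]
    have : (j + 1) * #Z = j * #Z + #Z := by ring
    omega

/-- If small sets expand by a factor `g + 2`, then a vertex of the core reaches `g ^ r` vertices. -/
theorem exists_reach_of_expansion {V : Type*} [DecidableEq V] {D : Digraph V} {d : ℝ} {Z : Finset V}
    {r g : ℕ} (hg : 2 ≤ g) {x : V} (hx : x ∈ outCore D d Z r)
    (hexp : ∀ X Y : Finset V, (∃ j < r, #X = g ^ j) →
      (∀ x ∈ X, d ≤ #(Y.filter fun y => D.Adj x y)) → (g + 2) * #X ≤ #Y) (j : ℕ) (hj : j ≤ r) :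
    ∃ L U : Finset V, L ⊆ outCore D d Z (r - j) ∧ #L = g ^ j ∧ U ⊆ Z ∧ #U ≤ 2 * g ^ j ∧
      ∀ y ∈ L, HasDipathIn D U j x y := by
  induction j with
  | zero =>
    refine ⟨{x}, {x}, by simpa using hx, by simp, ?_, by simp, ?_⟩
    · simpa using outCore_subset D d Z r hx
    · intro y hy
      rw [Finset.mem_singleton] at hy
      subst hy
      exact ⟨fun _ => y, fun a b _ => Fin.ext (by omega), rfl, rfl, by simp,
        fun i => i.elim0⟩
  | succ j ih =>
    obtain ⟨L, U, hL, hcL, hUZ, hcU, hpath⟩ := ih (by omega)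
    -- The layer reached after j arcs lies in core number r - j, so its vertices have at least `d`
    -- out-neighbours in the next larger core.
    have hrj : r - j = (r - (j + 1)) + 1 := by omega
    rw [hrj] at hL
    set Z' := outCore D d Z (r - (j + 1)) with hZ'
    let Y := Z'.filter fun y => ∃ l ∈ L, D.Adj l y
    have hY : (g + 2) * #L ≤ #Y := by
      refine hexp L Y ⟨j, by omega, hcL⟩ fun l hl => ?_
      have h1 : d ≤ #(Z'.filter fun y => D.Adj l y) := (Finset.mem_filter.1 (hL hl)).2
      refine h1.trans (Nat.cast_le.2 (Finset.card_le_card ?_))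
      intro y hy
      simp only [Y, mem_filter] at hy ⊢
      exact ⟨⟨hy.1, l, hl, hy.2⟩, hy.2⟩
    -- Of the expansion factor g + 2, the summand 2 pays for discarding the at most 2g^j vertices
    -- already used; this keeps the walks injective.
    have hYU : g ^ (j + 1) ≤ #(Y \ U) := by
      have h1 := Finset.le_card_sdiff U Y
      rw [hcL] at hY
      have h2 : (g + 2) * g ^ j = g ^ (j + 1) + 2 * g ^ j := by ring
      omega
    obtain ⟨L', hL'sub, hL'card⟩ := Finset.exists_subset_card_eq hYU
    have hL'Y : ∀ y ∈ L', y ∈ Y ∧ y ∉ U := fun y hy => Finset.mem_sdiff.1 (hL'sub hy)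
    have hL'Z : L' ⊆ Z' := fun y hy => (Finset.mem_filter.1 (hL'Y y hy).1).1
    refine ⟨L', U ∪ L', hL'Z, hL'card, ?_, ?_, ?_⟩
    · exact Finset.union_subset hUZ (hL'Z.trans (outCore_subset D d Z _))
    · refine (Finset.card_union_le _ _).trans ?_
      have : 2 * g ^ j ≤ g ^ (j + 1) := by
        rw [pow_succ, mul_comm]
        exact Nat.mul_le_mul_left _ hg
      omega
    · intro y hy
      obtain ⟨l, hl, hly⟩ := (Finset.mem_filter.1 (hL'Y y hy).1).2
      exact (hpath l hl).extend Finset.subset_union_left (hL'Y y hy).2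
        (Finset.mem_union_right _ hy) hly

end Pseudorandom

/-! ### Orientations of pseudorandom graphs expand. -/

section Expansion

open Finset
open scoped Classical

/-- The polylogarithmic factor in the expansion statement. -/
noncomputable def expansionConst (r : ℕ) (L : ℝ) : ℝ := (36 * (16 * (r + 2)) * L) ^ r

/-- `g` is the integer part of the (q+1)-th root of zs/(18aL)^(q+1); rounding loses at most a factor
2, hence 36. With p = s^(q+1), the last inequality says that the out-degree threshold pz/a exceeds
what pseudorandomness would allow if a layer failed to grow. -/
theorem exists_layer_growth {q : ℕ} {a L s z : ℝ} (ha : 1 ≤ a) (hL : 1 ≤ L) (hs : 0 < s)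
    (hs1 : s ≤ 1) (hz : (36 * a * L) ^ (q + 1) ≤ z * s ^ (q + 2)) :
    ∃ g : ℕ, 2 ≤ g ∧ z * s / (36 * a * L) ^ (q + 1) ≤ (g : ℝ) ^ (q + 1) ∧
      4 * (s ^ (q + 1) * (g : ℝ) ^ (q + 1)) + 9 * g * L < s ^ (q + 1) * z / a := by
  have ha0 : 0 < a := by linarith
  have hL0 : 0 < L := by linarith
  have haL : 1 ≤ a * L := one_le_mul_of_one_le_of_one_le ha hL
  have hb1 : (1 : ℝ) ≤ 36 * a * L := by linarith
  have hK1 : (1 : ℝ) ≤ (36 * a * L) ^ (q + 1) := one_le_pow₀ hb1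
  have hzs : 1 ≤ z * s ^ (q + 2) := hK1.trans hz
  have hz0 : 0 < z := by
    by_contra h
    have : z * s ^ (q + 2) ≤ 0 := mul_nonpos_of_nonpos_of_nonneg (not_lt.1 h) (by positivity)
    linarith
  set w : ℝ := z * s / (18 * a * L) ^ (q + 1) with hw
  have hw0 : 0 < w := by positivity
  set t : ℝ := w ^ (((q + 1 : ℕ) : ℝ)⁻¹) with ht
  have ht0 : 0 ≤ t := by positivity
  have htp : t ^ (q + 1) = w := Real.rpow_inv_natCast_pow hw0.le (by omega)
  have hsplit : (36 * a * L) ^ (q + 1) = 2 ^ (q + 1) * (18 * a * L) ^ (q + 1) := by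
    rw [← mul_pow]; congr 1; ring
  have hwK : w = z * s / (36 * a * L) ^ (q + 1) * 2 ^ (q + 1) := by
    rw [hw, hsplit]
    field_simp
  have ht2 : 2 ≤ t := by
    refine le_of_pow_le_pow_left₀ (n := q + 1) (by omega) ht0 ?_
    rw [htp, hwK]
    refine le_mul_of_one_le_left (by positivity) ?_
    rw [one_le_div (by positivity)]
    refine hz.trans (mul_le_mul_of_nonneg_left ?_ hz0.le)
    calc s ^ (q + 2) ≤ s ^ 1 := pow_le_pow_of_le_one hs.le hs1 (by omega)
      _ = s := pow_one s
  have hgt : (⌊t⌋₊ : ℝ) ≤ t := Nat.floor_le ht0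
  have hg2 : 2 ≤ ⌊t⌋₊ := Nat.le_floor (by exact_mod_cast ht2)
  have hg2' : (2 : ℝ) ≤ ⌊t⌋₊ := by exact_mod_cast hg2
  have hgt' : t < ⌊t⌋₊ + 1 := Nat.lt_floor_add_one t
  have hgpow : (⌊t⌋₊ : ℝ) ^ (q + 1) ≤ w := htp ▸ pow_le_pow_left₀ (by positivity) hgt _
  refine ⟨⌊t⌋₊, hg2, ?_, ?_⟩
  · have h1 : (t / 2) ^ (q + 1) ≤ (⌊t⌋₊ : ℝ) ^ (q + 1) :=
      pow_le_pow_left₀ (by positivity) (by linarith) _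
    rw [div_pow, htp, hwK, mul_div_assoc, div_self (by positivity), mul_one] at h1
    exact h1
  · have h1 : t ≤ s ^ (q + 1) * z / (18 * a * L) := by
      refine le_of_pow_le_pow_left₀ (n := q + 1) (by omega) (by positivity) ?_
      rw [htp, hw, div_pow]
      refine div_le_div_of_nonneg_right ?_ (by positivity)
      have e : (s ^ (q + 1) * z) ^ (q + 1) = z * s * (z * s ^ (q + 2)) ^ q := by ring
      rw [e]
      exact le_mul_of_one_le_right (by positivity) (one_le_pow₀ hzs)
    have h2 : 9 * (⌊t⌋₊ : ℝ) * L ≤ s ^ (q + 1) * z / a / 2 := by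
      calc 9 * (⌊t⌋₊ : ℝ) * L ≤ 9 * (s ^ (q + 1) * z / (18 * a * L)) * L := by
            gcongr
            exact hgt.trans h1
        _ = s ^ (q + 1) * z / a / 2 := by field_simp; ring
    have h3 : w ≤ z / (18 * a) := by
      rw [hw]
      refine div_le_div₀ hz0.le (mul_le_of_le_one_right hz0.le hs1) (by positivity) ?_
      calc 18 * a ≤ 18 * a * L := le_mul_of_one_le_right (by positivity) hL
        _ = (18 * a * L) ^ 1 := (pow_one _).symm
        _ ≤ (18 * a * L) ^ (q + 1) := pow_le_pow_right₀ (by linarith) (by omega)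
    have h4 : 4 * (s ^ (q + 1) * (⌊t⌋₊ : ℝ) ^ (q + 1)) ≤ 4 * (s ^ (q + 1) * (z / (18 * a))) := by
      gcongr
      exact hgpow.trans h3
    have h5 : 4 * (s ^ (q + 1) * (z / (18 * a))) = s ^ (q + 1) * z / a * (2 / 9) := by
      field_simp; ring
    have h6 : 0 < s ^ (q + 1) * z / a := by positivity
    linarith

theorem IsPseudorandom.isPathExpanding {n q m : ℕ} {s : ℝ} {G : SimpleGraph (Fin n)}
    (hs : 0 < s) (hs1 : s ≤ 1) (hL : 1 ≤ Real.log n) (hG : IsPseudorandom (s ^ (q + 1)) G)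
    (hm : expansionConst (q + 1) (Real.log n) ≤ m * s ^ (q + 2))
    {D : Digraph (Fin n)} (hD : IsOrientation D G) :
    IsPathExpanding D (q + 1) m (s / expansionConst (q + 1) (Real.log n)) := by
  intro Z hZ
  set L := Real.log n with hLdef
  set a : ℝ := 16 * (((q + 1 : ℕ) : ℝ) + 2) with ha
  have haq : a = 16 * q + 48 := by rw [ha]; push_cast; ring
  have hK : expansionConst (q + 1) L = (36 * a * L) ^ (q + 1) := rfl
  have hq0 : (0 : ℝ) ≤ q := Nat.cast_nonneg q
  have ha1 : 1 ≤ a := by linarith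
  have hmZ : (m : ℝ) ≤ #Z := by exact_mod_cast hZ
  have hz : (36 * a * L) ^ (q + 1) ≤ #Z * s ^ (q + 2) := by
    rw [← hK]
    exact hm.trans (mul_le_mul_of_nonneg_right hmZ (by positivity))
  obtain ⟨g, hg2, hgδ, hglt⟩ := exists_layer_growth ha1 hL hs hs1 hz
  set z : ℝ := ((#Z : ℕ) : ℝ) with hzdef
  set p : ℝ := s ^ (q + 1) with hp
  have hp0 : 0 < p := by positivity
  have haL : 1 ≤ a * L := one_le_mul_of_one_le_of_one_le ha1 hL
  have hpz : 36 * a * L ≤ p * z := by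
    calc 36 * a * L = (36 * a * L) ^ 1 := (pow_one _).symm
      _ ≤ (36 * a * L) ^ (q + 1) := pow_le_pow_right₀ (by linarith) (by omega)
      _ ≤ z * s ^ (q + 2) := hz
      _ ≤ z * s ^ (q + 1) := mul_le_mul_of_nonneg_left
          (pow_le_pow_of_le_one hs.le hs1 (by omega)) (Nat.cast_nonneg _)
      _ = p * z := mul_comm _ _
  have hp1 : p ≤ 1 := pow_le_one₀ hs.le hs1
  set d : ℝ := p * z / a with hd
  have hd0 : 0 < d := by
    have : 0 < p * z := by linarith
    positivity
  have hda : d * a = p * z := by rw [hd]; field_simp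
  -- Low out-degrees give `B` at most |B|d edges, while pseudorandomness forces about p|B|²/4. The
  -- choice a = 16(q+3) makes this bound |B| by |Z|/(q+2).
  have hB : ∀ B ⊆ Z, (∀ x ∈ B, (#(B.filter fun y => D.Adj x y) : ℝ) < d) →
      (q + 2) * #B ≤ #Z := by
    intro B _ hBd
    rcases B.eq_empty_or_nonempty with rfl | hne
    · simp
    have h1 : (edgeCount G.Adj (insidePairs B) : ℝ) ≤ #B * d := by
      calc (edgeCount G.Adj (insidePairs B) : ℝ)
          ≤ ((∑ x ∈ B, #(B.filter fun y => D.Adj x y) : ℕ) : ℝ) :=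
            Nat.cast_le.2 (hD.edgeCount_insidePairs_le B)
        _ = ∑ x ∈ B, (#(B.filter fun y => D.Adj x y) : ℝ) := by push_cast; rfl
        _ ≤ ∑ x ∈ B, d := Finset.sum_le_sum fun x hx => (hBd x hx).le
        _ = #B * d := by rw [Finset.sum_const, nsmul_eq_mul]
    have h2 := hG.lower B hne
    have h3 := card_mul_pred_le_insidePairs B
    have hb0 : (0 : ℝ) < #B := by exact_mod_cast hne.card_pos
    set b : ℝ := ((#B : ℕ) : ℝ) with hb
    have h4 : p * (b * (b - 1)) ≤ p * (2 * #(insidePairs B)) := mul_le_mul_of_nonneg_left h3 hp0.le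
    have h5 : b * (p * (b - 1)) ≤ b * (4 * d + 12 * L) := by linarith
    have h6 : p * (b - 1) ≤ 4 * d + 12 * L := le_of_mul_le_mul_left h5 hb0
    have h7 : p * ((q + 2) * b) ≤ p * z := by
      have e1 : (q + 2) * (p * (b - 1)) ≤ (q + 2) * (4 * d + 12 * L) :=
        mul_le_mul_of_nonneg_left h6 (by positivity)
      have e2 : d * (16 * q + 48) = p * z := by rw [← haq]; exact hda
      have e3 : 36 * (16 * q + 48) * L ≤ p * z := by rw [← haq]; exact hpz
      have e4 : 0 ≤ q * L := by positivity
      have e5 : (q : ℝ) * p ≤ q * L := mul_le_mul_of_nonneg_left (by linarith) hq0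
      nlinarith
    have h8 : ((q : ℝ) + 2) * b ≤ z := le_of_mul_le_mul_left h7 hp0
    rw [hb, hzdef] at h8
    exact_mod_cast h8
  -- q + 1 rounds, each deleting at most a proportion 1/(q+2), leave a nonempty core.
  have hcore := card_outCore (D := D) (d := d) (Z := Z) (r := q + 2) hB (q + 1)
  have hZpos : 0 < #Z := by
    have : 0 < p * z := by linarith
    have h : 0 < z := pos_of_mul_pos_right this hp0.le
    rw [hzdef] at h
    exact_mod_cast h
  have hcore' : (outCore D d Z (q + 1)).Nonempty := by
    rw [Finset.nonempty_iff_ne_empty]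
    intro h
    rw [h] at hcore
    simp only [card_empty, mul_zero, zero_add] at hcore
    have := Nat.le_of_mul_le_mul_right hcore hZpos
    omega
  obtain ⟨x, hx⟩ := hcore'
  -- If `Y` were too small, the |X|d arcs from `X` to `Y` would violate the upper edge bound: since
  -- g|X| ≤ g^(q+1), it would give d ≤ 4pg^(q+1) + 9gL, against `hglt`.
  have hexp : ∀ X Y : Finset (Fin n), (∃ j < q + 1, #X = g ^ j) →
      (∀ x ∈ X, d ≤ #(Y.filter fun y => D.Adj x y)) → (g + 2) * #X ≤ #Y := by
    rintro X Y ⟨j, hj, hXj⟩ hXY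
    have hg0 : 0 < g := by omega
    have hXpos : 0 < #X := by rw [hXj]; positivity
    have hXne : X.Nonempty := Finset.card_pos.1 hXpos
    obtain ⟨x₀, hx₀⟩ := hXne
    have hYne : Y.Nonempty := by
      have h1 : (0 : ℝ) < #(Y.filter fun y => D.Adj x₀ y) := lt_of_lt_of_le hd0 (hXY x₀ hx₀)
      have h2 : 0 < #(Y.filter fun y => D.Adj x₀ y) := by exact_mod_cast h1
      exact (Finset.card_pos.1 h2).mono (Finset.filter_subset _ _)
    by_contra hcon
    have hcon' : (#Y : ℝ) ≤ (g + 2) * #X := by exact_mod_cast (not_le.1 hcon).le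
    have h1 : #X * d ≤ (edgeCount G.Adj (crossPairs X Y) : ℝ) := by
      calc #X * d = ∑ x ∈ X, d := by rw [Finset.sum_const, nsmul_eq_mul]
        _ ≤ ∑ x ∈ X, (#(Y.filter fun y => D.Adj x y) : ℝ) := Finset.sum_le_sum hXY
        _ = ((∑ x ∈ X, #(Y.filter fun y => D.Adj x y) : ℕ) : ℝ) := by push_cast; rfl
        _ ≤ _ := Nat.cast_le.2 (hD.sum_outDegree_le X Y)
    have h2 := hG.upper X Y ⟨x₀, hx₀⟩ hYne
    have hX0 : (0 : ℝ) < #X := by exact_mod_cast hXpos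
    have hg2' : (2 : ℝ) ≤ g := by exact_mod_cast hg2
    have hXle : (g : ℝ) * #X ≤ (g : ℝ) ^ (q + 1) := by
      rw [hXj]
      push_cast
      rw [← pow_succ']
      exact pow_le_pow_right₀ (by linarith) (by omega)
    have h3 : (#X : ℝ) * d ≤ #X * (2 * p * ((g + 2) * #X) + 3 * (g + 3) * L) := by
      have e1 : 2 * p * (#X * #Y) ≤ 2 * p * (#X * ((g + 2) * #X)) := by gcongr
      have e2 : 3 * ((#X : ℝ) + #Y) * L ≤ 3 * (#X + (g + 2) * #X) * L := by gcongr
      linarith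
    have h4 : d ≤ 2 * p * ((g + 2) * #X) + 3 * (g + 3) * L := le_of_mul_le_mul_left h3 hX0
    have h5 : 2 * p * (((g : ℝ) + 2) * #X) ≤ 4 * (p * (g : ℝ) ^ (q + 1)) := by
      have e1 : ((g : ℝ) + 2) * #X ≤ 2 * g * #X :=
        mul_le_mul_of_nonneg_right (by linarith) hX0.le
      have e2 : ((g : ℝ) + 2) * #X ≤ 2 * (g : ℝ) ^ (q + 1) := by linarith
      have e3 := mul_le_mul_of_nonneg_left e2 (by positivity : 0 ≤ 2 * p)
      linarith
    have h6 : 3 * ((g : ℝ) + 3) * L ≤ 9 * g * L :=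
      mul_le_mul_of_nonneg_right (by linarith) (by linarith)
    linarith
  obtain ⟨T, U, -, hTcard, hUZ, -, hpath⟩ :=
    exists_reach_of_expansion hg2 hx hexp (q + 1) le_rfl
  refine ⟨x, outCore_subset D d Z _ hx, ?_⟩
  have h1 : s / expansionConst (q + 1) L * z ≤ (g : ℝ) ^ (q + 1) := by
    rw [hK]
    refine le_trans (le_of_eq ?_) hgδ
    ring
  refine h1.trans ?_
  have h2 : g ^ (q + 1) ≤ #(Z.filter fun y => HasDipathIn D Z (q + 1) x y) := by
    rw [← hTcard]
    refine Finset.card_le_card fun y hy => ?_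
    have hy' := (hpath y hy).mono hUZ
    refine Finset.mem_filter.2 ⟨?_, hy'⟩
    obtain ⟨f, -, -, hl, hfZ, -⟩ := hy'
    exact hl ▸ hfZ _
  exact_mod_cast h2

end Expansion

/-! ### Tail bounds, pseudorandomness with high probability, and the upper bound. -/

section UpperBound

open Finset
open scoped Classical

/-- The probability of the event `S` in the binomial model, as a finite sum. -/
noncomputable def graphProb {n : ℕ} (p : ℝ) (S : SimpleGraph (Fin n) → Prop) : ℝ :=
  ∑ G : SimpleGraph (Fin n) with S G, graphWeight p G.Adj

theorem graphProb_nonneg {n : ℕ} {p : ℝ} (h0 : 0 ≤ p) (h1 : p ≤ 1)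
    (S : SimpleGraph (Fin n) → Prop) : 0 ≤ graphProb p S :=
  Finset.sum_nonneg fun _ _ => graphWeight_nonneg h0 h1 _

theorem graphProb_mono {n : ℕ} {p : ℝ} (h0 : 0 ≤ p) (h1 : p ≤ 1)
    {S T : SimpleGraph (Fin n) → Prop} (h : ∀ G, S G → T G) : graphProb p S ≤ graphProb p T := by
  refine Finset.sum_le_sum_of_subset_of_nonneg ?_ fun _ _ _ => graphWeight_nonneg h0 h1 _
  intro G hG
  simp only [mem_filter, mem_univ, true_and] at hG ⊢
  exact h G hG

theorem graphProb_or_le {n : ℕ} {p : ℝ} (h0 : 0 ≤ p) (h1 : p ≤ 1)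
    (S T : SimpleGraph (Fin n) → Prop) :
    graphProb p (fun G => S G ∨ T G) ≤ graphProb p S + graphProb p T := by
  simp only [graphProb, Finset.sum_filter]
  rw [← Finset.sum_add_distrib]
  refine Finset.sum_le_sum fun G _ => ?_
  have := graphWeight_nonneg h0 h1 G.Adj
  by_cases hS : S G <;> by_cases hT : T G <;> simp [hS, hT, this]

theorem graphProb_exists_le {n : ℕ} {p : ℝ} (h0 : 0 ≤ p) (h1 : p ≤ 1) {ι : Type*} (I : Finset ι)
    (S : ι → SimpleGraph (Fin n) → Prop) :
    graphProb p (fun G => ∃ i ∈ I, S i G) ≤ ∑ i ∈ I, graphProb p (S i) := by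
  induction I using Finset.induction_on with
  | empty => simp [graphProb]
  | insert i I hi ih =>
    rw [Finset.sum_insert hi]
    refine le_trans ?_ ((graphProb_or_le h0 h1 _ _).trans (add_le_add_right ih _))
    refine graphProb_mono h0 h1 fun G hG => ?_
    simpa using hG

theorem graphProb_add_graphProb_not {n : ℕ} (p : ℝ) (S : SimpleGraph (Fin n) → Prop) :
    graphProb p S + graphProb p (fun G => ¬ S G) = 1 := by
  rw [graphProb, graphProb, Finset.sum_filter_add_sum_filter_not, sum_graphWeight]

/-- The Markov inequality. -/
theorem graphProb_mul_le {n : ℕ} {p : ℝ} (h0 : 0 ≤ p) (h1 : p ≤ 1) (X : SimpleGraph (Fin n) → ℝ)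
    (hX : ∀ G, 0 ≤ X G) (t : ℝ) :
    graphProb p (fun G => t ≤ X G) * t ≤ ∑ G, graphWeight p G.Adj * X G := by
  rw [graphProb, Finset.sum_mul]
  refine le_trans (Finset.sum_le_sum fun G hG => ?_)
    (Finset.sum_le_sum_of_subset_of_nonneg (Finset.filter_subset _ _)
      fun G _ _ => mul_nonneg (graphWeight_nonneg h0 h1 _) (hX G))
  exact mul_le_mul_of_nonneg_left (Finset.mem_filter.1 hG).2 (graphWeight_nonneg h0 h1 _)

/-- Exponential moment with base e: since e < 3, each pair contributes at most 1 + 2p ≤ exp(2p). -/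
theorem graphProb_upper_tail {n : ℕ} {p : ℝ} (h0 : 0 ≤ p) (h1 : p ≤ 1)
    {T : Finset (Fin n × Fin n)} (hT : T ⊆ ltPairs n) (u : ℝ) :
    graphProb p (fun G => 2 * p * #T + u ≤ edgeCount G.Adj T) ≤ Real.exp (-u) := by
  have hM := graphProb_mul_le h0 h1 (fun G => Real.exp 1 ^ edgeCount G.Adj T)
    (fun G => by positivity) (Real.exp (2 * p * #T + u))
  rw [sum_graphWeight_mul_pow p (Real.exp 1) hT] at hM
  have h2 : (1 - p + p * Real.exp 1) ^ #T ≤ Real.exp (2 * p * #T) := by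
    rw [mul_comm (2 * p), Real.exp_nat_mul]
    refine pow_le_pow_left₀ ?_ ?_ _
    · have := Real.exp_pos 1
      nlinarith
    · have he := Real.exp_one_lt_d9
      have := Real.add_one_le_exp (2 * p)
      nlinarith
  have h3 : graphProb p (fun G => 2 * p * #T + u ≤ edgeCount G.Adj T)
      ≤ graphProb p (fun G => Real.exp (2 * p * #T + u) ≤ Real.exp 1 ^ edgeCount G.Adj T) := by
    refine graphProb_mono h0 h1 fun G hG => ?_
    rw [← Real.exp_nat_mul, mul_one]
    exact Real.exp_le_exp.2 hG
  rw [Real.exp_add] at hM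
  have h4 := mul_le_mul_of_nonneg_right h3
    (by positivity : 0 ≤ Real.exp (2 * p * #T) * Real.exp u)
  rw [Real.exp_add] at h4
  have h5 : graphProb p (fun G => 2 * p * #T + u ≤ edgeCount G.Adj T) * Real.exp u
      * Real.exp (2 * p * #T) ≤ 1 * Real.exp (2 * p * #T) := by
    linarith
  rw [Real.exp_neg, ← one_div, le_div_iff₀ (Real.exp_pos u)]
  exact le_of_mul_le_mul_right h5 (Real.exp_pos _)

/-- Exponential moment with base 1/e ≤ 1/2: each pair contributes at most 1 - p/2 ≤ exp(-p/2). -/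
theorem graphProb_lower_tail {n : ℕ} {p : ℝ} (h0 : 0 ≤ p) (h1 : p ≤ 1)
    {T : Finset (Fin n × Fin n)} (hT : T ⊆ ltPairs n) (u : ℝ) :
    graphProb p (fun G => (edgeCount G.Adj T : ℝ) ≤ p * #T / 2 - u) ≤ Real.exp (-u) := by
  have hM := graphProb_mul_le h0 h1 (fun G => Real.exp (-1) ^ edgeCount G.Adj T)
    (fun G => by positivity) (Real.exp (-(p * #T / 2) + u))
  rw [sum_graphWeight_mul_pow p (Real.exp (-1)) hT] at hM
  have h2 : (1 - p + p * Real.exp (-1)) ^ #T ≤ Real.exp (-(p * #T / 2)) := by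
    have : -(p * #T / 2) = (#T : ℝ) * (-(p / 2)) := by ring
    rw [this, Real.exp_nat_mul]
    refine pow_le_pow_left₀ ?_ ?_ _
    · have := Real.exp_pos (-1)
      nlinarith
    · have he : Real.exp (-1) ≤ 1 / 2 := by
        rw [Real.exp_neg, ← one_div]
        have := Real.exp_one_gt_d9
        exact one_div_le_one_div_of_le (by norm_num) (by linarith)
      have := Real.add_one_le_exp (-(p / 2))
      nlinarith
  have h3 : graphProb p (fun G => (edgeCount G.Adj T : ℝ) ≤ p * #T / 2 - u)
      ≤ graphProb p (fun G =>
        Real.exp (-(p * #T / 2) + u) ≤ Real.exp (-1) ^ edgeCount G.Adj T) := by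
    refine graphProb_mono h0 h1 fun G hG => ?_
    rw [← Real.exp_nat_mul]
    exact Real.exp_le_exp.2 (by linarith)
  have h4 := mul_le_mul_of_nonneg_right h3
    (by positivity : 0 ≤ Real.exp (-(p * #T / 2)) * Real.exp u)
  rw [Real.exp_add] at h4 hM
  have h5 : graphProb p (fun G => (edgeCount G.Adj T : ℝ) ≤ p * #T / 2 - u) * Real.exp u
      * Real.exp (-(p * #T / 2)) ≤ 1 * Real.exp (-(p * #T / 2)) := by
    linarith
  rw [Real.exp_neg, ← one_div, le_div_iff₀ (Real.exp_pos u)]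
  exact le_of_mul_le_mul_right h5 (Real.exp_pos _)

/-- A deviation of 3 log n per vertex beats the number of sets: the sum over all sets is (1 +
n^(-3))^n ≤ exp(n^(-2)), and the empty set accounts for the 1. -/
theorem sum_nonempty_exp_le {n : ℕ} (hn : 0 < n) :
    ∑ B : Finset (Fin n) with B.Nonempty, Real.exp (-(3 * #B * Real.log n))
      ≤ Real.exp (1 / (n : ℝ) ^ 2) - 1 := by
  have hn' : (0 : ℝ) < n := by exact_mod_cast hn
  have h1 : ∀ B : Finset (Fin n),
      Real.exp (-(3 * #B * Real.log n)) = (1 / (n : ℝ) ^ 3) ^ #B := by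
    intro B
    have : -(3 * #B * Real.log n) = (#B : ℝ) * (-Real.log ((n : ℝ) ^ 3)) := by
      rw [Real.log_pow]; push_cast; ring
    rw [this, Real.exp_nat_mul, Real.exp_neg, Real.exp_log (by positivity), one_div]
  have h2 : ∑ B : Finset (Fin n), Real.exp (-(3 * #B * Real.log n))
      = (1 / (n : ℝ) ^ 3 + 1) ^ n := by
    have := Finset.sum_pow_mul_eq_add_pow (1 / (n : ℝ) ^ 3) 1 (univ : Finset (Fin n))
    rw [Finset.powerset_univ, Finset.card_univ, Fintype.card_fin] at this
    rw [← this]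
    refine Finset.sum_congr rfl fun B _ => ?_
    rw [h1, one_pow, mul_one]
  have h3 : (1 / (n : ℝ) ^ 3 + 1) ^ n ≤ Real.exp (1 / (n : ℝ) ^ 2) := by
    have : 1 / (n : ℝ) ^ 2 = n * (1 / (n : ℝ) ^ 3) := by field_simp
    rw [this, Real.exp_nat_mul]
    exact pow_le_pow_left₀ (by positivity) (Real.add_one_le_exp _) _
  have h4 := Finset.sum_filter_add_sum_filter_not (univ : Finset (Finset (Fin n)))
    (fun B => B.Nonempty) (fun B => Real.exp (-(3 * #B * Real.log n)))
  have h5 : (univ : Finset (Finset (Fin n))).filter (fun B => ¬ B.Nonempty) = {∅} := by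
    ext B
    simp
  rw [h5, Finset.sum_singleton, h2] at h4
  simp only [card_empty, Nat.cast_zero, mul_zero, zero_mul, neg_zero, Real.exp_zero] at h4
  linarith

theorem graphProb_not_isPseudorandom_le {n : ℕ} (hn : 0 < n) {p : ℝ} (h0 : 0 ≤ p) (h1 : p ≤ 1) :
    graphProb p (fun G : SimpleGraph (Fin n) => ¬ IsPseudorandom p G)
      ≤ (Real.exp (1 / (n : ℝ) ^ 2) - 1) + (Real.exp (1 / (n : ℝ) ^ 2) - 1) ^ 2 := by
  let P : Finset (Finset (Fin n)) := univ.filter fun B => B.Nonempty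
  have hsub : ∀ G : SimpleGraph (Fin n), ¬ IsPseudorandom p G →
      (∃ B ∈ P, (edgeCount G.Adj (insidePairs B) : ℝ)
        ≤ p * #(insidePairs B) / 2 - 3 * #B * Real.log n) ∨
      ∃ XY ∈ P ×ˢ P, 2 * p * #(crossPairs XY.1 XY.2) + 3 * (#XY.1 + #XY.2) * Real.log n
        ≤ edgeCount G.Adj (crossPairs XY.1 XY.2) := by
    intro G hG
    by_contra hcon
    push Not at hcon
    refine hG ⟨fun B hB => ?_, fun X Y hX hY => ?_⟩
    · exact (hcon.1 B (by simpa [P] using hB)).le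
    · refine (hcon.2 (X, Y) (by simp [P, hX, hY])).le.trans ?_
      have : (#(crossPairs X Y) : ℝ) ≤ #X * #Y := by exact_mod_cast card_crossPairs_le X Y
      have := mul_le_mul_of_nonneg_left this (by linarith : 0 ≤ 2 * p)
      simp only
      linarith
  refine (graphProb_mono h0 h1 hsub).trans ((graphProb_or_le h0 h1 _ _).trans (add_le_add ?_ ?_))
  · refine (graphProb_exists_le h0 h1 _ _).trans ?_
    exact (Finset.sum_le_sum fun B _ =>
      graphProb_lower_tail h0 h1 (Finset.filter_subset _ _) _).trans (sum_nonempty_exp_le hn)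
  · refine (graphProb_exists_le h0 h1 _ _).trans ?_
    calc ∑ XY ∈ P ×ˢ P, graphProb p (fun G =>
          2 * p * #(crossPairs XY.1 XY.2) + 3 * (#XY.1 + #XY.2) * Real.log n
            ≤ edgeCount G.Adj (crossPairs XY.1 XY.2))
        ≤ ∑ XY ∈ P ×ˢ P, Real.exp (-(3 * #XY.1 * Real.log n))
            * Real.exp (-(3 * #XY.2 * Real.log n)) := by
          refine Finset.sum_le_sum fun XY _ => ?_
          refine (graphProb_upper_tail h0 h1 (Finset.filter_subset _ _) _).trans (le_of_eq ?_)
          rw [← Real.exp_add]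
          congr 1
          ring
      _ = (∑ X ∈ P, Real.exp (-(3 * #X * Real.log n))) ^ 2 := by
          rw [Finset.sum_product, sq, Finset.sum_mul_sum]
      _ ≤ _ := pow_le_pow_left₀ (Finset.sum_nonneg fun _ _ => (Real.exp_pos _).le)
          (sum_nonempty_exp_le hn) 2

theorem numFreeOrientations_eq_card {V W : Type*} [Fintype V] [DecidableEq V] (G : SimpleGraph V)
    (H : Digraph W) : numFreeOrientations G H
      = #(univ.filter fun D : Digraph V => IsOrientation D G ∧ ¬ ContainsDigraph D H) := by
  rw [numFreeOrientations, ← Set.ncard_coe_finset]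
  simp

/-- The expected number of free orientations, restricted to graphs all of whose orientations are
expanding. -/
theorem sum_graphWeight_mul_numFreeOrientations_le {n r m : ℕ} {p δ : ℝ} (h0 : 0 ≤ p) (h1 : p ≤ 1)
    (S : SimpleGraph (Fin n) → Prop)
    (hS : ∀ G, S G → ∀ D, IsOrientation D G → IsPathExpanding D r m δ) :
    ∑ G : SimpleGraph (Fin n), graphWeight p G.Adj *
        (if S G then (numFreeOrientations G (directedCycle (r + 2)) : ℝ) else 0)
      ≤ ∑ D ∈ freeExpandingDigraphs r m δ n,
          graphWeight p (fun i j => D.Adj i j ∨ D.Adj j i) := by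
  let O : SimpleGraph (Fin n) → Finset (Digraph (Fin n)) := fun G =>
    univ.filter fun D => IsOrientation D G ∧ ¬ ContainsDigraph D (directedCycle (r + 2))
  let w : Digraph (Fin n) → ℝ := fun D => graphWeight p (fun i j => D.Adj i j ∨ D.Adj j i)
  have hw : ∀ G, ∀ D ∈ O G, w D = graphWeight p G.Adj := by
    intro G D hD
    have hD := (Finset.mem_filter.1 hD).2.1
    have : (fun i j => D.Adj i j ∨ D.Adj j i) = G.Adj := by
      ext i j
      exact (hD.adj_iff i j).symm
    simp only [w, this]
  have e1 : ∑ G : SimpleGraph (Fin n), graphWeight p G.Adj *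
        (if S G then (numFreeOrientations G (directedCycle (r + 2)) : ℝ) else 0)
      = ∑ x ∈ (univ.filter S).sigma O, w x.2 := by
    rw [Finset.sum_sigma, Finset.sum_filter]
    refine Finset.sum_congr rfl fun G _ => ?_
    split_ifs with hG
    · rw [Finset.sum_congr rfl (hw G), Finset.sum_const, nsmul_eq_mul, mul_comm,
        numFreeOrientations_eq_card]
    · rw [mul_zero]
  -- An orientation determines its graph, so summing over pairs is summing over digraphs.
  have hinj : Set.InjOn (fun x : (_ : SimpleGraph (Fin n)) × Digraph (Fin n) => x.2)
      ((univ.filter S).sigma O) := by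
    rintro ⟨G, D⟩ hx ⟨G', D'⟩ hx' heq
    simp only [coe_sigma, Set.mem_sigma_iff, O, coe_filter, mem_univ, true_and,
      Set.mem_ofPred_eq] at hx hx' heq
    subst heq
    have : G = G' := by
      ext i j
      rw [hx.2.1.adj_iff, hx'.2.1.adj_iff]
    rw [this]
  rw [e1, ← Finset.sum_image (f := w) hinj]
  refine Finset.sum_le_sum_of_subset_of_nonneg ?_ fun _ _ _ => graphWeight_nonneg h0 h1 _
  intro D hD
  obtain ⟨⟨G, D⟩, hx, rfl⟩ := Finset.mem_image.1 hD
  simp only [mem_sigma, O, mem_filter, mem_univ, true_and] at hx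
  simp only [freeExpandingDigraphs, mem_filter, mem_univ, true_and]
  exact ⟨hx.2.1.asymm, hx.2.2, hS G hx.1 D hx.2.1⟩

theorem graphProb_upper_bound {n q : ℕ} {s : ℝ} (hs : 0 < s) (hs1 : s ≤ 1)
    (hL : 1 ≤ Real.log n) :
    graphProb (s ^ (q + 1)) (fun G : SimpleGraph (Fin n) =>
      7 * expansionConst (q + 1) (Real.log n) * Real.log n ^ 2 * (n / s)
        < Real.log (numFreeOrientations G (directedCycle (q + 1 + 2))))
      ≤ (Real.exp (1 / (n : ℝ) ^ 2) - 1) + (Real.exp (1 / (n : ℝ) ^ 2) - 1) ^ 2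
        + Real.exp (-n) := by
  have hn : 0 < n := by
    rcases Nat.eq_zero_or_pos n with rfl | h
    · simp at hL
      linarith
    · exact h
  have hn' : (1 : ℝ) ≤ n := by exact_mod_cast hn
  set L := Real.log n with hLdef
  set K := expansionConst (q + 1) L with hK
  set p := s ^ (q + 1) with hp
  have hp0 : 0 < p := by positivity
  have hp1 : p ≤ 1 := pow_le_one₀ hs.le hs1
  have hK2 : 2 ≤ K := by
    have hq0 : (0 : ℝ) ≤ q := Nat.cast_nonneg q
    have hb : (2 : ℝ) ≤ 36 * (16 * (((q + 1 : ℕ) : ℝ) + 2)) * L := by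
      push_cast
      nlinarith
    calc (2 : ℝ) ≤ (36 * (16 * (((q + 1 : ℕ) : ℝ) + 2)) * L) ^ 1 := by rwa [pow_one]
      _ ≤ K := pow_le_pow_right₀ (by linarith) (by omega)
  -- The smallest set size at which expansion is available; then pm ≤ 2K/s.
  set m := ⌈K / s ^ (q + 2)⌉₊ with hm
  have hsq : s ^ (q + 2) ≤ 1 := pow_le_one₀ hs.le hs1
  have hKs : K ≤ K / s ^ (q + 2) := by
    rw [le_div_iff₀ (by positivity)]
    nlinarith
  have hm1 : K / s ^ (q + 2) ≤ m := Nat.le_ceil _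
  have hm2 : (m : ℝ) ≤ 2 * (K / s ^ (q + 2)) := by
    have := Nat.ceil_lt_add_one (by positivity : 0 ≤ K / s ^ (q + 2))
    linarith
  have hmpos : 0 < m := by
    have : (0 : ℝ) < m := by linarith
    exact_mod_cast this
  set δ := s / K with hδ
  have hδ0 : 0 < δ := by positivity
  have hδ1 : δ ≤ 1 := by
    rw [hδ, div_le_one (by linarith)]
    linarith
  -- Enough steps for (1 - δ)^y ≤ 1/n, which brings n candidates down to at most 1 < m.
  set y := ⌈L / δ⌉₊ with hy
  have hLδ : 1 ≤ L / δ := by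
    rw [le_div_iff₀ hδ0]
    linarith
  have hy1 : L / δ ≤ y := Nat.le_ceil _
  have hy2 : (y : ℝ) ≤ 2 * (L / δ) := by
    have := Nat.ceil_lt_add_one (by positivity : 0 ≤ L / δ)
    linarith
  have hNy : (n : ℝ) * (1 - δ) ^ y < m := by
    have e1 : (1 - δ) ^ y ≤ Real.exp (-L) := by
      calc (1 - δ) ^ y ≤ (Real.exp (-δ)) ^ y :=
            pow_le_pow_left₀ (by linarith) (Real.one_sub_le_exp_neg δ) _
        _ = Real.exp (y * -δ) := (Real.exp_nat_mul _ _).symm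
        _ ≤ Real.exp (-L) := by
            refine Real.exp_le_exp.2 ?_
            have := (div_le_iff₀ hδ0).1 hy1
            linarith
    have e2 : (n : ℝ) * Real.exp (-L) = 1 := by
      rw [Real.exp_neg, hLdef, Real.exp_log (by linarith)]
      exact mul_inv_cancel₀ (by linarith)
    have e3 := mul_le_mul_of_nonneg_left e1 (by linarith : (0 : ℝ) ≤ n)
    linarith
  have hexpand : ∀ G : SimpleGraph (Fin n), IsPseudorandom p G → ∀ D, IsOrientation D G →
      IsPathExpanding D (q + 1) m δ := by
    intro G hG D hD
    exact hG.isPathExpanding hs hs1 hL (by rwa [← div_le_iff₀ (by positivity)]) hD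
  set W : ℝ := (1 + p) ^ m * (n + 1 : ℝ) ^ y with hW
  have hW0 : 0 < W := by positivity
  have hE := (sum_graphWeight_mul_numFreeOrientations_le hp0.le hp1 _ hexpand).trans
    (sum_freeExpandingDigraphs_le hp0.le hp1 hδ1 hmpos n y hNy n le_rfl)
  -- Markov with slack e^n over the mean bound W^n: failure probability e^(-n) at a cost of only n
  -- in the logarithm.
  have hM := (graphProb_mul_le hp0.le hp1
    (fun G : SimpleGraph (Fin n) => if IsPseudorandom p G then
      (numFreeOrientations G (directedCycle (q + 1 + 2)) : ℝ) else 0)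
    (fun G => by split_ifs <;> positivity) (W ^ n * Real.exp n)).trans hE
  have hlogW : Real.log (W ^ n * Real.exp n) ≤ 7 * K * L ^ 2 * (n / s) := by
    rw [Real.log_mul (by positivity) (Real.exp_pos _).ne', Real.log_exp, Real.log_pow, hW,
      Real.log_mul (by positivity) (by positivity), Real.log_pow, Real.log_pow]
    have a1 : (m : ℝ) * Real.log (1 + p) ≤ 2 * (K / s) := by
      have b1 : Real.log (1 + p) ≤ p := by
        have := Real.log_le_sub_one_of_pos (by linarith : 0 < 1 + p)
        linarith
      calc (m : ℝ) * Real.log (1 + p) ≤ 2 * (K / s ^ (q + 2)) * p :=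
            mul_le_mul hm2 b1 (Real.log_nonneg (by linarith)) (by positivity)
        _ = 2 * (K / s) := by
            rw [hp]
            field_simp
            ring
    have a2 : Real.log ((n : ℝ) + 1) ≤ 2 * L := by
      have b1 : (2 : ℝ) ≤ n := by
        by_contra hlt
        have : n = 1 := by
          have : n < 2 := by exact_mod_cast (not_le.1 hlt)
          omega
        rw [hLdef, this] at hL
        simp at hL
        linarith
      calc Real.log ((n : ℝ) + 1) ≤ Real.log ((n : ℝ) ^ 2) :=
            Real.log_le_log (by linarith) (by nlinarith)
        _ = 2 * L := by rw [Real.log_pow]; norm_num; rfl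
    have a3 : (y : ℝ) * Real.log ((n : ℝ) + 1) ≤ 4 * L ^ 2 * (K / s) := by
      calc (y : ℝ) * Real.log ((n : ℝ) + 1) ≤ 2 * (L / δ) * (2 * L) :=
            mul_le_mul hy2 a2 (Real.log_nonneg (by linarith)) (by positivity)
        _ = 4 * L ^ 2 * (K / s) := by
            rw [hδ]
            field_simp
            ring
    have a4 : 1 ≤ K / s := by
      rw [le_div_iff₀ hs]
      linarith
    have a5 : 1 ≤ L ^ 2 := one_le_pow₀ hL
    have a6 : K / s ≤ L ^ 2 * (K / s) := le_mul_of_one_le_left (by linarith) a5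
    have a7 : (n : ℝ) * (m * Real.log (1 + p) + y * Real.log (n + 1)) + n
        ≤ n * (7 * (L ^ 2 * (K / s))) := by
      have := mul_le_mul_of_nonneg_left
        (by linarith : (m * Real.log (1 + p) + y * Real.log ((n : ℝ) + 1)) + 1
          ≤ 7 * (L ^ 2 * (K / s))) (by linarith : (0 : ℝ) ≤ n)
      linarith
    refine a7.trans (le_of_eq ?_)
    ring
  have hsub : ∀ G : SimpleGraph (Fin n),
      7 * K * L ^ 2 * (n / s) < Real.log (numFreeOrientations G (directedCycle (q + 1 + 2))) →
      ¬ IsPseudorandom p G ∨ W ^ n * Real.exp n ≤ if IsPseudorandom p G then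
        (numFreeOrientations G (directedCycle (q + 1 + 2)) : ℝ) else 0 := by
    intro G hG
    by_cases hps : IsPseudorandom p G
    · right
      rw [if_pos hps]
      -- A zero count has `Real.log 0 = 0`, which cannot exceed the nonnegative bound.
      have hpos : (0 : ℝ) < numFreeOrientations G (directedCycle (q + 1 + 2)) := by
        rcases Nat.eq_zero_or_pos (numFreeOrientations G (directedCycle (q + 1 + 2))) with h | h
        · rw [h, Nat.cast_zero, Real.log_zero] at hG
          exact absurd hG (not_lt.2 (by positivity))
        · exact_mod_cast h
      exact ((Real.log_lt_log_iff (by positivity) hpos).1 (lt_of_le_of_lt hlogW hG)).le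
    · exact Or.inl hps
  refine (graphProb_mono hp0.le hp1 hsub).trans ((graphProb_or_le hp0.le hp1 _ _).trans
    (add_le_add (graphProb_not_isPseudorandom_le hn hp0.le hp1) ?_))
  rw [Real.exp_neg, ← one_div, le_div_iff₀ (Real.exp_pos _)]
  refine le_of_mul_le_mul_left (a := W ^ n) ?_ (by positivity)
  linarith

end UpperBound

/-! ### Many cycle-free orientations from a partition into blocks. -/

section LowerBound

open Finset
open scoped Classical

/-- An injective map of the cycle of length `k` to `G` whose image lies in one of the blocks of
`b` consecutive vertices. -/
def IsBlockCycle {n : ℕ} (G : SimpleGraph (Fin n)) (b k : ℕ) (f : Fin k → Fin n) : Prop :=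
  Function.Injective f ∧ (∀ i j, (f i : ℕ) / b = (f j : ℕ) / b) ∧
    ∀ i j, (directedCycle k).Adj i j → G.Adj (f i) (f j)

/-- The pairs `i < j` in the same block. -/
noncomputable def blockPairs (n b : ℕ) : Finset (Fin n × Fin n) :=
  (ltPairs n).filter fun e => (e.1 : ℕ) / b = (e.2 : ℕ) / b

/-- The edges inside blocks that are not contained in cycles of length `k` inside blocks. -/
noncomputable def freeBlockEdges {n : ℕ} (G : SimpleGraph (Fin n)) (b k : ℕ) :
    Finset (Fin n × Fin n) :=
  (blockPairs n b).filter fun e => G.Adj e.1 e.2 ∧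
    ∀ f, IsBlockCycle G b k f → ∀ i j, (directedCycle k).Adj i j → s(f i, f j) ≠ s(e.1, e.2)

/-- Orient all edges forwards, except those in `F`. -/
def flipOrientation {n : ℕ} (G : SimpleGraph (Fin n)) (F : Finset (Fin n × Fin n)) :
    Digraph (Fin n) where
  Adj u v := G.Adj u v ∧ (u < v ∧ (u, v) ∉ F ∨ v < u ∧ (v, u) ∈ F)

theorem isOrientation_flipOrientation {n : ℕ} (G : SimpleGraph (Fin n))
    (F : Finset (Fin n × Fin n)) : IsOrientation (flipOrientation G F) G := by
  constructor
  · intro u v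
    simp only [flipOrientation]
    constructor
    · intro h
      have h' := h.symm
      rcases lt_or_gt_of_ne h.ne with hlt | hlt
      · by_cases hF : (u, v) ∈ F
        · exact Or.inr ⟨h', Or.inr ⟨hlt, hF⟩⟩
        · exact Or.inl ⟨h, Or.inl ⟨hlt, hF⟩⟩
      · by_cases hF : (v, u) ∈ F
        · exact Or.inl ⟨h, Or.inr ⟨hlt, hF⟩⟩
        · exact Or.inr ⟨h', Or.inl ⟨hlt, hF⟩⟩
    · rintro (h | h)
      · exact h.1
      · exact h.1.symm
  · rintro u v ⟨_, ⟨h1, h2⟩ | ⟨h1, h2⟩⟩ ⟨_, ⟨h3, h4⟩ | ⟨h3, h4⟩⟩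
    · exact absurd h1 (not_lt.2 h3.le)
    · exact h2 h4
    · exact h4 h2
    · exact absurd h1 (not_lt.2 h3.le)

theorem directedCycle_adj_castSucc_succ {q : ℕ} (i : Fin (q + 2)) :
    (directedCycle (q + 3)).Adj i.castSucc i.succ := by
  simp only [directedCycle, Fin.val_succ, Fin.val_castSucc]
  rw [Nat.mod_eq_of_lt (by omega)]

theorem directedCycle_adj_last_zero {q : ℕ} :
    (directedCycle (q + 3)).Adj (Fin.last (q + 2)) 0 := by
  simp [directedCycle]

/-- Arcs never decrease the block index, because flipped edges stay inside blocks. A directed cycle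
is therefore a block cycle, so none of its edges lies in `F`; all its arcs point forwards, which
cannot close up. -/
theorem flipOrientation_free {n b q : ℕ} (G : SimpleGraph (Fin n)) {F : Finset (Fin n × Fin n)}
    (hF : F ⊆ freeBlockEdges G b (q + 3)) :
    ¬ ContainsDigraph (flipOrientation G F) (directedCycle (q + 3)) := by
  rintro ⟨f, hf⟩
  have hblock : ∀ u v, (flipOrientation G F).Adj u v → (u : ℕ) / b ≤ (v : ℕ) / b := by
    rintro u v ⟨_, ⟨h1, _⟩ | ⟨_, h2⟩⟩
    · exact Nat.div_le_div_right (Fin.le_def.1 h1.le)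
    · exact (Finset.mem_filter.1 (Finset.mem_filter.1 (hF h2)).1).2.symm.le
  have hmono : Monotone fun i => ((f i : Fin n) : ℕ) / b :=
    Fin.monotone_iff_le_succ.2 fun i => hblock _ _ (hf _ _ (directedCycle_adj_castSucc_succ i))
  have hlast : ((f (Fin.last (q + 2)) : Fin n) : ℕ) / b ≤ ((f 0 : Fin n) : ℕ) / b :=
    hblock _ _ (hf _ _ directedCycle_adj_last_zero)
  have hconst : ∀ i, ((f i : Fin n) : ℕ) / b = ((f 0 : Fin n) : ℕ) / b := fun i =>
    le_antisymm ((hmono (Fin.le_last i)).trans hlast) (hmono (Fin.zero_le i))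
  have hcyc : IsBlockCycle G b (q + 3) f :=
    ⟨f.injective, fun i j => (hconst i).trans (hconst j).symm, fun i j hij => (hf i j hij).1⟩
  have hlt : ∀ i j, (directedCycle (q + 3)).Adj i j → f i < f j := by
    intro i j hij
    rcases (hf i j hij).2 with h | h
    · exact h.1
    · exact absurd Sym2.eq_swap ((Finset.mem_filter.1 (hF h.2)).2.2 f hcyc i j hij)
  have hstrict : StrictMono f :=
    Fin.strictMono_iff_lt_succ.2 fun i => hlt _ _ (directedCycle_adj_castSucc_succ i)
  exact absurd (hlt _ _ directedCycle_adj_last_zero)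
    (not_lt.2 (hstrict.monotone (Fin.zero_le _)))

/-- `F` is recovered from its orientation as the set of backward edges, so distinct subsets give
distinct orientations. -/
theorem two_pow_le_numFreeOrientations {n b q : ℕ} (G : SimpleGraph (Fin n)) :
    2 ^ #(freeBlockEdges G b (q + 3)) ≤ numFreeOrientations G (directedCycle (q + 3)) := by
  rw [numFreeOrientations_eq_card, ← Finset.card_powerset]
  refine Finset.card_le_card_of_injOn (flipOrientation G) ?_ ?_
  · intro F hF
    have hF := Finset.mem_powerset.1 (Finset.mem_coe.1 hF)
    simpa using ⟨isOrientation_flipOrientation G F, flipOrientation_free G hF⟩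
  · have key : ∀ F F' : Finset (Fin n × Fin n), F ⊆ freeBlockEdges G b (q + 3) →
        flipOrientation G F = flipOrientation G F' → F ⊆ F' := by
      rintro F F' hF heq ⟨u, v⟩ he
      have hmem := Finset.mem_filter.1 (hF he)
      have hlt : u < v := by
        simpa [ltPairs] using (Finset.mem_filter.1 hmem.1).1
      have h1 : (flipOrientation G F).Adj v u := ⟨hmem.2.1.symm, Or.inr ⟨hlt, he⟩⟩
      rw [heq] at h1
      rcases h1.2 with h | h
      · exact absurd hlt (not_lt.2 h.1.le)
      · exact h.2
    intro F hF F' hF' heq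
    have hF := Finset.mem_powerset.1 (Finset.mem_coe.1 hF)
    have hE := Finset.mem_powerset.1 (Finset.mem_coe.1 hF')
    exact Finset.Subset.antisymm (key F F' hF heq) (key F' F hE heq.symm)

/-- The successor of a vertex on the directed cycle. -/
def cycleNext {k : ℕ} (i : Fin k) : Fin k := ⟨(i + 1) % k, Nat.mod_lt _ (by have := i.2; omega)⟩

theorem directedCycle_adj_iff {k : ℕ} (i j : Fin k) :
    (directedCycle k).Adj i j ↔ j = cycleNext i := by
  simp [directedCycle, cycleNext, Fin.ext_iff]

/-- The unordered pair `{u, v}`, written in increasing order. -/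
def sortPair {n : ℕ} (u v : Fin n) : Fin n × Fin n := (min u v, max u v)

theorem sortPair_of_sym2_eq {n : ℕ} {u v : Fin n} {e : Fin n × Fin n} (he : e.1 < e.2)
    (h : s(u, v) = s(e.1, e.2)) : sortPair u v = e := by
  rcases Sym2.eq_iff.1 h with ⟨rfl, rfl⟩ | ⟨rfl, rfl⟩
  · exact Prod.ext (min_eq_left he.le) (max_eq_right he.le)
  · exact Prod.ext (min_eq_right he.le) (max_eq_left he.le)

/-- Every block edge that is not free lies on a block cycle, and each such cycle accounts for at
most k edges. -/
theorem edgeCount_blockPairs_le {n b k : ℕ} (G : SimpleGraph (Fin n)) :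
    edgeCount G.Adj (blockPairs n b)
      ≤ #(freeBlockEdges G b k) + k * #(univ.filter fun f => IsBlockCycle G b k f) := by
  let N : Finset (Fin n × Fin n) :=
    ((univ.filter fun f => IsBlockCycle G b k f) ×ˢ (univ : Finset (Fin k))).image
      fun x => sortPair (x.1 x.2) (x.1 (cycleNext x.2))
  have hsub : (blockPairs n b).filter (fun e => G.Adj e.1 e.2) ⊆ freeBlockEdges G b k ∪ N := by
    intro e he
    obtain ⟨heb, heG⟩ := Finset.mem_filter.1 he
    by_cases hfree : e ∈ freeBlockEdges G b k
    · exact Finset.mem_union_left _ hfree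
    · refine Finset.mem_union_right _ ?_
      have : ∃ f, IsBlockCycle G b k f ∧ ∃ i j, (directedCycle k).Adj i j ∧
          s(f i, f j) = s(e.1, e.2) := by
        by_contra hcon
        push Not at hcon
        exact hfree (Finset.mem_filter.2 ⟨heb, heG, fun f hf i j hij => hcon f hf i j hij⟩)
      obtain ⟨f, hf, i, j, hij, heq⟩ := this
      rw [directedCycle_adj_iff] at hij
      subst hij
      have hlt : e.1 < e.2 := by simpa [ltPairs] using (Finset.mem_filter.1 heb).1
      refine Finset.mem_image.2 ⟨(f, i), ?_, sortPair_of_sym2_eq hlt heq⟩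
      simpa using hf
  refine (Finset.card_le_card hsub).trans ((Finset.card_union_le _ _).trans
    (Nat.add_le_add_left ?_ _))
  refine Finset.card_image_le.trans (le_of_eq ?_)
  rw [Finset.card_product, Finset.card_univ, Fintype.card_fin, mul_comm]

/-- This is where length at least 3 matters: the steps of a cycle use distinct unordered pairs, so a
fixed cycle has probability p^(q+3). -/
theorem cycleNext_cycleNext_ne {q : ℕ} (i : Fin (q + 3)) : cycleNext (cycleNext i) ≠ i := by
  intro h
  have h1 : (((i : ℕ) + 1) % (q + 3) + 1) % (q + 3) = i := congrArg Fin.val h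
  have hi := i.2
  rcases Nat.lt_or_ge ((i : ℕ) + 1) (q + 3) with h2 | h2
  · rw [Nat.mod_eq_of_lt h2] at h1
    rcases Nat.lt_or_ge ((i : ℕ) + 2) (q + 3) with h3 | h3
    · rw [Nat.mod_eq_of_lt (by omega)] at h1
      omega
    · have : (i : ℕ) + 1 + 1 = q + 3 := by omega
      rw [this, Nat.mod_self] at h1
      omega
  · have : (i : ℕ) + 1 = q + 3 := by omega
    rw [this, Nat.mod_self, Nat.mod_eq_of_lt (by omega)] at h1
    omega

theorem cycleNext_ne {q : ℕ} (i : Fin (q + 3)) : cycleNext i ≠ i := by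
  intro h
  exact cycleNext_cycleNext_ne i (by rw [h, h])

theorem graphProb_isBlockCycle_le {n b q : ℕ} {p : ℝ} (h0 : 0 ≤ p) (h1 : p ≤ 1)
    (f : Fin (q + 3) → Fin n) :
    graphProb p (fun G => IsBlockCycle G b (q + 3) f)
      ≤ if Function.Injective f ∧ ∀ i j, (f i : ℕ) / b = (f j : ℕ) / b then p ^ (q + 3) else 0 := by
  split_ifs with hf
  · let T : Finset (Fin n × Fin n) := univ.image fun i => sortPair (f i) (f (cycleNext i))
    have hT : T ⊆ ltPairs n := by
      intro e he
      obtain ⟨i, -, rfl⟩ := Finset.mem_image.1 he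
      have hne : f i ≠ f (cycleNext i) := fun h => cycleNext_ne i (hf.1 h).symm
      simpa [ltPairs, sortPair] using hne.symm
    have hcard : #T = q + 3 := by
      rw [Finset.card_image_of_injective, Finset.card_univ, Fintype.card_fin]
      intro i j hij
      have hs : s(f i, f (cycleNext i)) = s(f j, f (cycleNext j)) := by
        have h1 := congrArg Prod.fst hij
        have h2 := congrArg Prod.snd hij
        simp only [sortPair] at h1 h2
        rw [Sym2.eq_iff]
        rcases le_total (f i) (f (cycleNext i)) with ha | ha <;>
          rcases le_total (f j) (f (cycleNext j)) with hb | hb <;>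
          simp [ha, hb] at h1 h2 <;> simp [h1, h2]
      rcases Sym2.eq_iff.1 hs with ⟨h, _⟩ | ⟨h, h'⟩
      · exact hf.1 h
      · have e1 := hf.1 h
        have e2 := hf.1 h'
        rw [← e2] at e1
        exact absurd e1.symm (cycleNext_cycleNext_ne i)
    have hprob : graphProb p (fun G => ∀ e ∈ T, G.Adj e.1 e.2) = p ^ (q + 3) := by
      have h := sum_graphWeight_filter_subset p hT
      rw [hcard] at h
      rw [← h, graphProb]
      congr!
    rw [← hprob]
    refine graphProb_mono h0 h1 fun G hG e he => ?_
    obtain ⟨i, -, rfl⟩ := Finset.mem_image.1 he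
    have hadj := hG.2.2 i (cycleNext i) ((directedCycle_adj_iff _ _).2 rfl)
    simp only [sortPair]
    rcases le_total (f i) (f (cycleNext i)) with ha | ha
    · rwa [min_eq_left ha, max_eq_right ha]
    · rw [min_eq_right ha, max_eq_left ha]
      exact hadj.symm
  · refine le_of_eq (Finset.sum_eq_zero fun G hG => ?_)
    have := (Finset.mem_filter.1 hG).2
    exact absurd ⟨this.1, this.2.1⟩ hf

/-- The injective maps from `Fin k` with values in a single block. -/
noncomputable def blockTuples (n b k : ℕ) : Finset (Fin k → Fin n) :=
  univ.filter fun f => Function.Injective f ∧ ∀ i j, (f i : ℕ) / b = (f j : ℕ) / b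

/-- The first vertex fixes the block; each other vertex is then determined by its residue mod b. -/
theorem card_blockTuples_le {n b k : ℕ} (hb : 0 < b) :
    #(blockTuples n b (k + 1)) ≤ n * b ^ k := by
  have : n * b ^ k = #(univ : Finset (Fin n × (Fin k → Fin b))) := by
    simp
  rw [this]
  refine Finset.card_le_card_of_injOn
    (fun f => (f 0, fun i => ⟨(f i.succ : ℕ) % b, Nat.mod_lt _ hb⟩)) (fun _ _ => by simp) ?_
  intro f hf g hg heq
  have hf := (Finset.mem_filter.1 (Finset.mem_coe.1 hf)).2
  have hg := (Finset.mem_filter.1 (Finset.mem_coe.1 hg)).2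
  simp only [Prod.mk.injEq] at heq
  funext i
  induction i using Fin.cases with
  | zero => exact heq.1
  | succ i =>
    have h1 : (f i.succ : ℕ) % b = (g i.succ : ℕ) % b := congrArg Fin.val (congrFun heq.2 i)
    have h2 : (f i.succ : ℕ) / b = (g i.succ : ℕ) / b := by
      rw [hf.2 i.succ 0, hg.2 i.succ 0, heq.1]
    ext
    rw [← Nat.div_add_mod (f i.succ : ℕ) b, ← Nat.div_add_mod (g i.succ : ℕ) b, h1, h2]

theorem blockTuples_two {n q : ℕ} : blockTuples n 2 (q + 3) = ∅ := by
  rw [Finset.eq_empty_iff_forall_notMem]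
  intro f hf
  have hf := (Finset.mem_filter.1 hf).2
  have h1 := hf.2 0 1
  have h2 := hf.2 0 2
  have n1 : (f 0 : ℕ) ≠ f 1 := fun h => by simpa [Fin.ext_iff] using hf.1 (Fin.ext h)
  have n2 : (f 0 : ℕ) ≠ f 2 := fun h => by
    have := congrArg Fin.val (hf.1 (Fin.ext h))
    simp [Nat.mod_eq_of_lt] at this
  have n3 : (f 1 : ℕ) ≠ f 2 := fun h => by
    have := congrArg Fin.val (hf.1 (Fin.ext h))
    simp [Nat.mod_eq_of_lt] at this
  omega

theorem sum_graphWeight_mul_blockCycles_le {n b q : ℕ} {p : ℝ} (h0 : 0 ≤ p) (h1 : p ≤ 1) :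
    ∑ G : SimpleGraph (Fin n), graphWeight p G.Adj *
        (#(univ.filter fun f => IsBlockCycle G b (q + 3) f) : ℝ)
      ≤ #(blockTuples n b (q + 3)) * p ^ (q + 3) := by
  calc ∑ G : SimpleGraph (Fin n), graphWeight p G.Adj *
        (#(univ.filter fun f => IsBlockCycle G b (q + 3) f) : ℝ)
      = ∑ f, graphProb p (fun G => IsBlockCycle G b (q + 3) f) := by
        simp only [graphProb, Finset.card_filter, Nat.cast_sum, Finset.mul_sum, Finset.sum_filter]
        rw [Finset.sum_comm]
        refine Finset.sum_congr rfl fun f _ => Finset.sum_congr rfl fun G _ => ?_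
        split_ifs <;> simp
    _ ≤ ∑ f : Fin (q + 3) → Fin n, if Function.Injective f ∧ ∀ i j, (f i : ℕ) / b = (f j : ℕ) / b
          then p ^ (q + 3) else 0 := Finset.sum_le_sum fun f _ => graphProb_isBlockCycle_le h0 h1 f
    _ = #(blockTuples n b (q + 3)) * p ^ (q + 3) := by
        rw [← Finset.sum_filter, Finset.sum_const, nsmul_eq_mul, blockTuples]

/-- Each complete block of length 2h contributes the h² pairs joining its first half to its second.
-/
theorem le_card_blockPairs {n h : ℕ} (hh : 0 < h) :
    n / (2 * h) * (h * h) ≤ #(blockPairs n (2 * h)) := by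
  have : n / (2 * h) * (h * h) = #(univ : Finset (Fin (n / (2 * h)) × Fin h × Fin h)) := by simp
  rw [this]
  have hbound : ∀ t : Fin (n / (2 * h)), (t : ℕ) * (2 * h) + 2 * h ≤ n := by
    intro t
    have h1 : ((t : ℕ) + 1) * (2 * h) ≤ n / (2 * h) * (2 * h) := Nat.mul_le_mul_right _ t.2
    have h2 := Nat.div_mul_le_self n (2 * h)
    linarith
  have hdiv : ∀ (t x : ℕ), x < 2 * h → (t * (2 * h) + x) / (2 * h) = t := by
    intro t x hx
    rw [mul_comm, Nat.mul_add_div (by omega), Nat.div_eq_of_lt hx, add_zero]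
  refine Finset.card_le_card_of_injOn (fun x =>
    (⟨x.1 * (2 * h) + x.2.1, by have := hbound x.1; have := x.2.1.2; omega⟩,
      ⟨x.1 * (2 * h) + (h + x.2.2), by have := hbound x.1; have := x.2.2.2; omega⟩)) ?_ ?_
  · rintro ⟨t, x, y⟩ _
    have hx := x.2
    have hy := y.2
    simp only [blockPairs, ltPairs, coe_filter, mem_filter, mem_univ, true_and, Set.mem_ofPred_eq,
      Fin.mk_lt_mk]
    refine ⟨by omega, ?_⟩
    rw [hdiv _ _ (by omega), hdiv _ _ (by omega)]
  · rintro ⟨t, x, y⟩ _ ⟨t', x', y'⟩ _ heq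
    simp only [Prod.mk.injEq, Fin.mk.injEq] at heq
    have hx := x.2
    have hx' := x'.2
    have ht : (t : ℕ) = t' := by
      rw [← hdiv t x (by omega), ← hdiv t' x' (by omega), heq.1]
    rw [ht] at heq
    simp only [Prod.mk.injEq, Fin.ext_iff]
    omega

end LowerBound

/-! ### The lower bound with high probability. -/

section LowerBoundProbability

open Finset
open scoped Classical

/-- The choice of half the block length for the lower bound. -/
theorem exists_halfBlock {n q : ℕ} {s L : ℝ} (hs : 0 < s) (hL : 2 ≤ L)
    (hn : 1 ≤ n * s ^ (q + 2)) (hn2 : 2 ≤ n) :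
    ∃ h : ℕ, 0 < h ∧ 2 * h ≤ n ∧ (h = 1 ∨ (h : ℝ) * s ^ (q + 2) * L ≤ 1) ∧
      1 ≤ 2 * L * (h * s ^ (q + 2)) := by
  have hL0 : 0 < L := by linarith
  have hs2 : 0 < s ^ (q + 2) := by positivity
  set x : ℝ := 1 / (s ^ (q + 2) * L) with hx
  have hx0 : 0 < x := by positivity
  have hxs : x * (s ^ (q + 2) * L) = 1 := by rw [hx]; field_simp
  -- For dense graphs the ideal half-length `x` drops below 1. Then h = 1, and blocks of two
  -- vertices contain no cycle at all.
  rcases lt_or_ge x 1 with hx1 | hx1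
  · refine ⟨1, one_pos, by omega, Or.inl rfl, ?_⟩
    have : 1 ≤ s ^ (q + 2) * L := by
      rw [← hxs]
      exact mul_le_of_le_one_left (by positivity) hx1.le
    push_cast
    linarith
  · have h1 : (⌊x⌋₊ : ℝ) ≤ x := Nat.floor_le hx0.le
    have h2 : x < ⌊x⌋₊ + 1 := Nat.lt_floor_add_one x
    have h3 : 1 ≤ ⌊x⌋₊ := Nat.le_floor (by exact_mod_cast hx1)
    have h3' : (1 : ℝ) ≤ ⌊x⌋₊ := by exact_mod_cast h3
    have hpos : 0 < s ^ (q + 2) * L := by positivity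
    refine ⟨⌊x⌋₊, h3, ?_, Or.inr ?_, ?_⟩
    · have h4 : 2 * x ≤ n := by
        refine le_of_mul_le_mul_right ?_ hpos
        have : (n : ℝ) * s ^ (q + 2) * 2 ≤ n * s ^ (q + 2) * L :=
          mul_le_mul_of_nonneg_left hL (by positivity)
        linarith
      have h5 : 2 * (⌊x⌋₊ : ℝ) ≤ n := by linarith
      exact_mod_cast h5
    · have := mul_le_mul_of_nonneg_right h1 hpos.le
      linarith
    · have := mul_le_mul_of_nonneg_right (by linarith : x ≤ 2 * (⌊x⌋₊ : ℝ)) hpos.le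
      linarith

theorem graphProb_lower_bound {n q : ℕ} {s : ℝ} (hs : 0 < s) (hs1 : s ≤ 1)
    (hL : 2 ≤ Real.log n) (hn : 1 ≤ n * s ^ (q + 2)) :
    graphProb (s ^ (q + 1)) (fun G : SimpleGraph (Fin n) =>
      Real.log (numFreeOrientations G (directedCycle (q + 3))) < n / s / (128 * Real.log n))
      ≤ Real.exp (-(n / (32 * Real.log n))) + 32 * (q + 3) * 2 ^ (q + 2) / Real.log n := by
  have hn2 : 2 ≤ n := by
    by_contra hlt
    have : n = 0 ∨ n = 1 := by omega
    rcases this with rfl | rfl <;> simp at hL <;> linarith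
  have hn0 : (0 : ℝ) < n := by exact_mod_cast (by omega : 0 < n)
  set L := Real.log n with hLdef
  have hL0 : 0 < L := by linarith
  set p := s ^ (q + 1) with hp
  have hp0 : 0 < p := by positivity
  have hp1 : p ≤ 1 := pow_le_one₀ hs.le hs1
  obtain ⟨h, hh, h2n, hor, hLh⟩ := exists_halfBlock hs hL hn hn2
  have hh' : (0 : ℝ) < h := by exact_mod_cast hh
  have hps : s ^ (q + 2) = p * s := by rw [hp]; ring
  set T := blockPairs n (2 * h) with hT
  have hTcard : (n : ℝ) * h / 4 ≤ #T := by
    have h1 : (((n / (2 * h) * (h * h) : ℕ)) : ℝ) ≤ #T := Nat.cast_le.2 (le_card_blockPairs hh)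
    have h2 : (n : ℝ) / (4 * h) ≤ ((n / (2 * h) : ℕ) : ℝ) := by
      have e1 : n < (n / (2 * h) + 1) * (2 * h) := by
        have := Nat.lt_div_mul_add (a := n) (b := 2 * h) (by omega)
        linarith
      have e2 : 1 ≤ n / (2 * h) := (Nat.one_le_div_iff (by omega)).2 h2n
      have e1' : (n : ℝ) < (((n / (2 * h) : ℕ) : ℝ) + 1) * (2 * h) := by exact_mod_cast e1
      have e2' : (1 : ℝ) ≤ ((n / (2 * h) : ℕ) : ℝ) := by exact_mod_cast e2
      rw [div_le_iff₀ (by positivity)]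
      nlinarith
    have h3 := mul_le_mul_of_nonneg_right h2 (by positivity : (0 : ℝ) ≤ h * h)
    have h4 : (n : ℝ) / (4 * h) * (h * h) = n * h / 4 := by field_simp
    push_cast at h1
    linarith
  set μ : ℝ := p * #T with hμ
  have hμ1 : p * n * h / 4 ≤ μ := by
    have := mul_le_mul_of_nonneg_left hTcard hp0.le
    rw [hμ]
    linarith
  have hpnh : n / s / (2 * L) ≤ p * n * h := by
    rw [div_div, div_le_iff₀ (by positivity)]
    have := mul_le_mul_of_nonneg_left hLh hn0.le
    rw [hps] at this
    linarith
  have hμ0 : 0 < μ := lt_of_lt_of_le (by positivity) hμ1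
  have hns : (n : ℝ) ≤ n / s := by
    rw [le_div_iff₀ hs]
    exact mul_le_of_le_one_right hn0.le hs1
  let X : SimpleGraph (Fin n) → ℕ := fun G =>
    #(univ.filter fun f => IsBlockCycle G (2 * h) (q + 3) f)
  -- If at least μ/4 block edges exist and at most μ/8 are spoiled by cycles, then μ/8 free edges
  -- remain. So failure needs either few block edges (lower tail) or many block cycles (Markov).
  have hsub : ∀ G : SimpleGraph (Fin n),
      Real.log (numFreeOrientations G (directedCycle (q + 3))) < n / s / (128 * L) →
      ((edgeCount G.Adj T : ℝ) ≤ p * #T / 2 - μ / 4) ∨ μ / (8 * (q + 3)) ≤ X G := by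
    intro G hG
    by_contra hcon
    push Not at hcon
    obtain ⟨hc1, hc2⟩ := hcon
    have e1 : (edgeCount G.Adj T : ℝ)
        ≤ #(freeBlockEdges G (2 * h) (q + 3)) + (q + 3) * X G := by
      exact_mod_cast edgeCount_blockPairs_le (b := 2 * h) (k := q + 3) G
    have e2 : ((q : ℝ) + 3) * X G ≤ μ / 8 := by
      rw [lt_div_iff₀ (by positivity)] at hc2
      linarith
    have e3 : μ / 8 ≤ #(freeBlockEdges G (2 * h) (q + 3)) := by linarith
    have e4 : (#(freeBlockEdges G (2 * h) (q + 3)) : ℝ) * Real.log 2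
        ≤ Real.log (numFreeOrientations G (directedCycle (q + 3))) := by
      rw [← Real.log_pow]
      refine Real.log_le_log (by positivity) ?_
      exact_mod_cast two_pow_le_numFreeOrientations (b := 2 * h) G
    have e5 : (1 : ℝ) / 2 ≤ Real.log 2 := by
      have := Real.log_two_gt_d9
      linarith
    have e6 : μ / 8 * (1 / 2)
        ≤ (#(freeBlockEdges G (2 * h) (q + 3)) : ℝ) * Real.log 2 :=
      mul_le_mul e3 e5 (by norm_num) (by positivity)
    have e7 : n / s / (128 * L) = n / s / (2 * L) / 64 := by
      field_simp
      norm_num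
    rw [e7] at hG
    linarith
  refine (graphProb_mono hp0.le hp1 hsub).trans ((graphProb_or_le hp0.le hp1 _ _).trans
    (add_le_add ?_ ?_))
  · refine (graphProb_lower_tail hp0.le hp1 (Finset.filter_subset _ _) _).trans ?_
    refine Real.exp_le_exp.2 (neg_le_neg ?_)
    have e1 : n / (32 * L) ≤ n / s / (32 * L) := div_le_div_of_nonneg_right hns (by positivity)
    have e2 : n / s / (32 * L) = n / s / (2 * L) / 16 := by
      field_simp
      norm_num
    linarith
  · have hM := (graphProb_mul_le hp0.le hp1 (fun G => (X G : ℝ)) (fun G => by positivity)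
      (μ / (8 * (q + 3)))).trans (sum_graphWeight_mul_blockCycles_le hp0.le hp1)
    set P := graphProb p (fun G => μ / (8 * (q + 3)) ≤ (X G : ℝ)) with hP
    have hP0 : 0 ≤ P := graphProb_nonneg hp0.le hp1 _
    have hRHS : (#(blockTuples n (2 * h) (q + 3)) : ℝ) * p ^ (q + 3) * L
        ≤ p * n * h * 2 ^ (q + 2) := by
      rcases hor with rfl | hor
      · rw [mul_one, blockTuples_two]
        simp only [card_empty, Nat.cast_zero, zero_mul]
        positivity
      · have c1 : (#(blockTuples n (2 * h) (q + 3)) : ℝ) ≤ n * (2 * h) ^ (q + 2) := by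
          exact_mod_cast card_blockTuples_le (n := n) (k := q + 2) (by omega : 0 < 2 * h)
        -- Up to constants, the ratio of expected block cycles to expected block edges is
        -- h^(q+1)p^(q+2) = (hs^(q+2))^(q+1), and the choice of `h` makes this at most 1/L.
        have c2 : (h : ℝ) ^ (q + 1) * p ^ (q + 2) * L ≤ 1 := by
          have d1 : (h : ℝ) ^ (q + 1) * p ^ (q + 2) = (h * s ^ (q + 2)) ^ (q + 1) := by
            rw [hp, mul_pow, ← pow_mul, ← pow_mul]
            congr 2
            ring
          have d2 : (h : ℝ) * s ^ (q + 2) ≤ 1 := by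
            have : (h : ℝ) * s ^ (q + 2) * 1 ≤ h * s ^ (q + 2) * L :=
              mul_le_mul_of_nonneg_left (by linarith) (by positivity)
            linarith
          have d3 : (h * s ^ (q + 2)) ^ (q + 1) ≤ (h : ℝ) * s ^ (q + 2) :=
            pow_le_of_le_one (by positivity) d2 (by omega)
          rw [d1]
          exact (mul_le_mul_of_nonneg_right d3 hL0.le).trans hor
        calc (#(blockTuples n (2 * h) (q + 3)) : ℝ) * p ^ (q + 3) * L
            ≤ n * (2 * h) ^ (q + 2) * p ^ (q + 3) * L := by gcongr
          _ = p * n * h * 2 ^ (q + 2) * (h ^ (q + 1) * p ^ (q + 2) * L) := by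
              rw [mul_pow]
              ring
          _ ≤ p * n * h * 2 ^ (q + 2) * 1 := mul_le_mul_of_nonneg_left c2 (by positivity)
          _ = _ := mul_one _
    rw [le_div_iff₀ hL0]
    have hpnh0 : 0 < p * n * h := by positivity
    refine le_of_mul_le_mul_right (a := p * n * h) ?_ hpnh0
    have f1 : P * (p * n * h / 4) ≤ P * μ := mul_le_mul_of_nonneg_left hμ1 hP0
    have f2 : P * μ ≤ #(blockTuples n (2 * h) (q + 3)) * p ^ (q + 3) * (8 * (q + 3)) := by
      rw [← mul_div_assoc, div_le_iff₀ (by positivity)] at hM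
      exact hM
    have f3 := mul_le_mul_of_nonneg_right (f1.trans f2) hL0.le
    have f4 := mul_le_mul_of_nonneg_right hRHS (by positivity : (0 : ℝ) ≤ 8 * (q + 3))
    linarith

end LowerBoundProbability

/-! ### Vanishing of the failure probability, and the density threshold in terms of s. -/

section Asymptotics

/-- The failure probability in the main theorem. -/
noncomputable def failureBound (q n : ℕ) : ℝ :=
  ((Real.exp (1 / (n : ℝ) ^ 2) - 1) + (Real.exp (1 / (n : ℝ) ^ 2) - 1) ^ 2 + Real.exp (-n))
    + (Real.exp (-(n / (32 * Real.log n))) + 32 * (q + 3) * 2 ^ (q + 2) / Real.log n)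

theorem tendsto_failureBound (q : ℕ) : Tendsto (failureBound q) atTop (𝓝 0) := by
  have hnat : Tendsto (fun n : ℕ => (n : ℝ)) atTop atTop := tendsto_natCast_atTop_atTop
  have hlog : Tendsto (fun n : ℕ => Real.log n) atTop atTop := Real.tendsto_log_atTop.comp hnat
  have h1 : Tendsto (fun n : ℕ => Real.exp (1 / (n : ℝ) ^ 2) - 1) atTop (𝓝 0) := by
    have e1 : Tendsto (fun n : ℕ => 1 / (n : ℝ) ^ 2) atTop (𝓝 0) :=
      tendsto_const_nhds.div_atTop ((tendsto_pow_atTop (by norm_num)).comp hnat)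
    have e2 := ((Real.continuous_exp.tendsto 0).comp e1).sub_const 1
    simpa using e2
  have h2 : Tendsto (fun n : ℕ => Real.exp (-(n : ℝ))) atTop (𝓝 0) :=
    Real.tendsto_exp_neg_atTop_nhds_zero.comp hnat
  have h3 : Tendsto (fun n : ℕ => Real.exp (-((n : ℝ) / (32 * Real.log n)))) atTop (𝓝 0) := by
    refine Real.tendsto_exp_neg_atTop_nhds_zero.comp ?_
    have hbase : Tendsto (fun x : ℝ => x / Real.log x) atTop atTop := by
      have := (Real.tendsto_exp_div_pow_atTop 1).comp Real.tendsto_log_atTop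
      refine this.congr' ?_
      filter_upwards [eventually_gt_atTop 0] with x hx
      simp [Real.exp_log hx]
    have := (hbase.comp hnat).atTop_div_const (by norm_num : (0 : ℝ) < 32)
    refine this.congr fun n => ?_
    simp only [Function.comp]
    rw [div_div, mul_comm]
  have h4 : Tendsto (fun n : ℕ => 32 * ((q : ℝ) + 3) * 2 ^ (q + 2) / Real.log n) atTop (𝓝 0) :=
    tendsto_const_nhds.div_atTop hlog
  have := ((h1.add (h1.pow 2)).add h2).add (h3.add h4)
  rw [zero_pow two_ne_zero, add_zero, add_zero, add_zero] at this
  exact this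

/-- The threshold is n^(-(q+1)/(q+2)); raising to the power q + 2 and taking (q+1)-th roots gives
1/n ≤ s^(q+2). -/
theorem one_le_mul_pow_of_rpow_le {q n : ℕ} {s : ℝ} (hn : 0 < n) (hs : 0 < s)
    (h : (n : ℝ) ^ (-1 + 1 / (((q + 3 : ℕ) : ℝ) - 1)) ≤ s ^ (q + 1)) :
    1 ≤ n * s ^ (q + 2) := by
  have hn' : (0 : ℝ) < n := by exact_mod_cast hn
  have h1 := pow_le_pow_left₀ (by positivity) h (q + 2)
  have hexp : (-1 + 1 / (((q + 3 : ℕ) : ℝ) - 1)) * ((q + 2 : ℕ) : ℝ) = -((q + 1 : ℕ) : ℝ) := by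
    push_cast
    have : (q : ℝ) + 3 - 1 ≠ 0 := by
      have : (0 : ℝ) ≤ q := Nat.cast_nonneg q
      linarith
    field_simp
    ring
  rw [← Real.rpow_mul_natCast hn'.le, hexp, Real.rpow_neg hn'.le, Real.rpow_natCast, ← inv_pow,
    ← pow_mul, mul_comm (q + 1), pow_mul] at h1
  have h2 : (n : ℝ)⁻¹ ≤ s ^ (q + 2) :=
    le_of_pow_le_pow_left₀ (by omega : q + 1 ≠ 0) (by positivity) h1
  have h3 := mul_le_mul_of_nonneg_left h2 hn'.le
  rwa [mul_inv_cancel₀ hn'.ne'] at h3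

end Asymptotics

/-! ### The main theorem. -/

theorem theorem1p2 (k : ℕ) (hk : 3 ≤ k) :
    ∃ C : ℝ, 0 < C ∧ ∃ a : ℕ, ∀ p : ℕ → unitInterval,
      (fun n : ℕ => (n : ℝ) ^ (-1 + 1 / ((k : ℝ) - 1))) =o[atTop] (fun n : ℕ => (p n : ℝ)) →
      Tendsto
        (fun n : ℕ => (SimpleGraph.binomialRandom (Fin n) (p n)).real
          {G : SimpleGraph (Fin n) |
            (n : ℝ) / (p n : ℝ) ^ (1 / ((k : ℝ) - 2)) / (C * Real.log n ^ a)
                ≤ Real.log (numFreeOrientations G (directedCycle k)) ∧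
            Real.log (numFreeOrientations G (directedCycle k))
                ≤ C * Real.log n ^ a * ((n : ℝ) / (p n : ℝ) ^ (1 / ((k : ℝ) - 2)))})
        atTop (𝓝 1) := by
  obtain ⟨q, rfl⟩ : ∃ q, k = q + 3 := ⟨k - 3, by omega⟩
  set c : ℝ := 36 * (16 * (((q + 1 : ℕ) : ℝ) + 2)) with hc
  have hc0 : 0 < c := by positivity
  -- The upper bound needs 7c^(q+1) and q + 3 logarithms (q + 1 from `expansionConst`, 2 from the
  -- per-vertex count); the lower bound needs 128 and one logarithm.
  refine ⟨7 * c ^ (q + 1) + 128, by positivity, q + 3, fun p hp => ?_⟩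
  have hlower : Tendsto (fun n : ℕ => 1 - failureBound q n) atTop (𝓝 1) := by
    simpa using (tendsto_failureBound q).const_sub 1
  refine tendsto_of_tendsto_of_tendsto_of_le_of_le' hlower tendsto_const_nhds ?_ ?_
  swap
  · exact Eventually.of_forall fun n => MeasureTheory.measureReal_le_one
  have hlog : Tendsto (fun n : ℕ => Real.log n) atTop atTop :=
    Real.tendsto_log_atTop.comp tendsto_natCast_atTop_atTop
  filter_upwards [hp.bound one_pos, hlog.eventually_ge_atTop 2, eventually_gt_atTop 0]
    with n hpn hL hn
  have hn' : (0 : ℝ) < n := by exact_mod_cast hn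
  have hpn' : (n : ℝ) ^ (-1 + 1 / (((q + 3 : ℕ) : ℝ) - 1)) ≤ (p n : ℝ) := by
    rw [one_mul, Real.norm_of_nonneg (by positivity),
      Real.norm_of_nonneg (p n).2.1] at hpn
    exact hpn
  have hp0 : 0 < (p n : ℝ) := lt_of_lt_of_le (by positivity) hpn'
  set s : ℝ := (p n : ℝ) ^ (1 / (((q + 3 : ℕ) : ℝ) - 2)) with hs
  have hs0 : 0 < s := by positivity
  have hexp : 1 / (((q + 3 : ℕ) : ℝ) - 2) = ((q + 1 : ℕ) : ℝ)⁻¹ := by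
    push_cast
    rw [one_div]
    congr 1
    ring
  have hsp : s ^ (q + 1) = (p n : ℝ) := by
    rw [hs, hexp]
    exact Real.rpow_inv_natCast_pow hp0.le (by omega)
  have hs1 : s ≤ 1 := by
    rw [hs, hexp]
    exact Real.rpow_le_one hp0.le (p n).2.2 (by positivity)
  have hns : 1 ≤ n * s ^ (q + 2) := one_le_mul_pow_of_rpow_le hn hs0 (by rwa [hsp])
  have hU := graphProb_upper_bound (n := n) (q := q) hs0 hs1 (by linarith)
  have hD := graphProb_lower_bound (n := n) (q := q) hs0 hs1 hL hns
  rw [hsp] at hU hD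
  set L := Real.log n with hLdef
  have hL0 : 0 < L := by linarith
  have hcU : 7 * expansionConst (q + 1) L * L ^ 2 * (n / s)
      ≤ (7 * c ^ (q + 1) + 128) * L ^ (q + 3) * (n / s) := by
    refine mul_le_mul_of_nonneg_right ?_ (by positivity)
    have e1 : 7 * expansionConst (q + 1) L * L ^ 2 = 7 * c ^ (q + 1) * L ^ (q + 3) := by
      rw [expansionConst, mul_pow, ← hc]
      ring
    rw [e1]
    exact mul_le_mul_of_nonneg_right (by linarith) (by positivity)
  have hcD : (n : ℝ) / s / ((7 * c ^ (q + 1) + 128) * L ^ (q + 3)) ≤ n / s / (128 * L) := by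
    refine div_le_div_of_nonneg_left (by positivity) (by positivity) ?_
    refine mul_le_mul ?_ ?_ hL0.le (by positivity)
    · have : 0 < c ^ (q + 1) := by positivity
      linarith
    · exact le_self_pow₀ (by linarith) (by omega)
  have hprob : ∀ S : Set (SimpleGraph (Fin n)),
      (SimpleGraph.binomialRandom (Fin n) (p n)).real S
        = graphProb (p n : ℝ) (fun G => G ∈ S) := binomialRandom_real_eq_sum (p n)
  rw [hprob, sub_le_iff_le_add]
  refine (graphProb_add_graphProb_not (p n : ℝ) _).symm.le.trans (add_le_add_right ?_ _)
  have hfail := (graphProb_or_le (n := n) (p n).2.1 (p n).2.2 _ _).trans (add_le_add hU hD)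
  refine le_trans (graphProb_mono (p n).2.1 (p n).2.2 fun G hG => ?_) hfail
  by_contra hcon
  push Not at hcon
  exact hG ⟨hcD.trans hcon.2, hcon.1.trans hcU⟩
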